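/- Let $a\ge 1$ and $k\ge 2$ be integers with $(a,k)\neq(1,2)$. Consider the following games on the edge set of the complete graph $K_n$, where $k\mid n$. The winning sets are the edge sets of the $P_k$-factors of $K_n$, i.e. of the spanning subgraphs all of whose connected components are paths with $k$ vertices. Two players alternately claim exactly $a$ previously unclaimed edges per move (all remaining edges if fewer than $a$ are left). In the $(a:a)$ Maker-Breaker $P_k$-factor game, Breaker moves first, a round is a move of Breaker followed by a move of Maker, and Maker wins at the moment when she has claimed all edges of some winning set; let $\tau_n(a:a)$ be the least $t$ such that Maker has a strategy to win within $t$ rounds against every play of Breaker ($\tau_n(a:a)=\infty$ if there is no such $t$). In the strong $(a:a)$ $P_k$-factor game, Red moves first against Blue, and the first player to have claimed all edges of some winning set wins. Then there is an integer $n_0=n_0(a,k)$ such that for every $n\ge n_0$ with $k\mid n$: (i) $\displaystyle \tau_n(a:a)=\left\lceil\frac{(k-1)n}{ka}\right\rceil$; (ii) Maker wins perfectly fast, i.e. $\tau_n(a:a)=\lceil m/a\rceil$, where $m$ is the minimum number of edges of a winning set; (iii) Red has a winning strategy in the strong $(a:a)$ $P_k$-factor game. -/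

import Mathlib

/-- A positional game: a finite board and a family of winning sets, each of them a subset of the
board. -/
structure PositionalGame (α : Type*) where
  /-- the board -/
  board : Finset α
  /-- the family of winning sets -/
  winning : Set (Finset α)
  /-- every winning set consists of elements of the board -/
  winning_subset : ∀ F ∈ winning, F ⊆ board

namespace PositionalGame

variable {α : Type*} [DecidableEq α]

/-- A history of play is the list of all moves (sets of claimed elements) made so far by the two
alternating players, *most recent move first*. `firstClaims h` is the set of the elements claimed
during `h` by the player who made the first move of the game: a move made after an even number of
moves is a move of that player. -/
def firstClaims : List (Finset α) → Finset α
  | [] => ∅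
  | S :: h => if Even h.length then firstClaims h ∪ S else firstClaims h

/-- The set of the elements claimed during `h` by the player who moves second. -/
def secondClaims : List (Finset α) → Finset α
  | [] => ∅
  | S :: h => if Even h.length then secondClaims h else secondClaims h ∪ S

/-- The free (not yet claimed) elements of the board after the history `h`. -/
def free (G : PositionalGame α) (h : List (Finset α)) : Finset α :=
  G.board \ (firstClaims h ∪ secondClaims h)

/-- A strategy of a player with bias `a`: given the whole history, it names the next move, which
consists of exactly `a` free elements (of all the free elements if fewer than `a` are left). -/
structure Strategy (G : PositionalGame α) (a : ℕ) where
  /-- the move made after a given history -/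
  move : List (Finset α) → Finset α
  move_subset : ∀ h, move h ⊆ G.free h
  card_move : ∀ h, (move h).card = min a (G.free h).card

variable {G : PositionalGame α} {a b : ℕ}

/-- The history after `i` moves when the first player plays `σ` and the second player plays `τ`. -/
def play (σ : G.Strategy a) (τ : G.Strategy b) : ℕ → List (Finset α)
  | 0 => []
  | i + 1 =>
    (if Even i then σ.move (play σ τ i) else τ.move (play σ τ i)) :: play σ τ i

/-- The set `C` contains all the elements of some winning set. -/
def Occupies (G : PositionalGame α) (C : Finset α) : Prop :=
  ∃ F ∈ G.winning, F ⊆ C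

/-- In the `(a : b)` Maker-Breaker game (Maker has bias `a`, Breaker has bias `b`, Breaker moves
first) Maker has a strategy to fully claim a winning set within `t` rounds, a round being a move of
Breaker followed by a move of Maker, whatever Breaker does. -/
def MakerWinsWithin (G : PositionalGame α) (a b t : ℕ) : Prop :=
  ∃ μ : G.Strategy a, ∀ β : G.Strategy b, G.Occupies (secondClaims (play β μ (2 * t)))

/-- The duration of the `(a : b)` Maker-Breaker game: the least `t` such that Maker has a strategy
to win within `t` rounds, and `⊤` if there is no such `t`. -/
noncomputable def duration (G : PositionalGame α) (a b : ℕ) : ℕ∞ :=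
  ⨅ (t : ℕ) (_ : G.MakerWinsWithin a b t), (t : ℕ∞)

/-- Maker wins the `(a : a)` Maker-Breaker game perfectly fast: its duration is `⌈m / a⌉`, where
`m` is the minimum size of a winning set. -/
def PerfectlyFast (G : PositionalGame α) (a : ℕ) : Prop :=
  ∃ m : ℕ, IsLeast (Finset.card '' G.winning) m ∧
    G.duration a a = ((⌈(m : ℚ) / (a : ℚ)⌉₊ : ℕ) : ℕ∞)

/-- Red (who moves first) has a winning strategy in the `(a : a)` strong game: whatever Blue does,
at some moment Red has fully claimed a winning set while Blue has not (claims only grow, so Blue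
has not done so earlier either). -/
def RedWinsStrong (G : PositionalGame α) (a : ℕ) : Prop :=
  ∃ ρ : G.Strategy a, ∀ β : G.Strategy a, ∃ i : ℕ,
    G.Occupies (firstClaims (play ρ β i)) ∧ ¬ G.Occupies (secondClaims (play ρ β i))

end PositionalGame

/-- `H` is a `P_k`-factor of the complete graph on its vertex set: a spanning graph each of whose
connected components is a path with `k` vertices. -/
def IsPathFactor {V : Type*} (k : ℕ) (H : SimpleGraph V) : Prop :=
  ∀ c : H.ConnectedComponent, Nonempty (c.toSimpleGraph ≃g SimpleGraph.pathGraph k)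

/-- The `P_k`-factor game on `K_n`: the board is `E(K_n)` and the winning sets are the edge sets of
the `P_k`-factors of `K_n`. -/
def pathFactorGame (n k : ℕ) : PositionalGame (Sym2 (Fin n)) where
  board := (⊤ : SimpleGraph (Fin n)).edgeFinset
  winning := {F | ∃ H : SimpleGraph (Fin n), IsPathFactor k H ∧ (F : Set (Sym2 (Fin n))) = H.edgeSet}
  winning_subset := by
    rintro F ⟨H, -, hF⟩ e he
    have h1 : e ∈ H.edgeSet := hF ▸ Finset.mem_coe.2 he
    exact SimpleGraph.mem_edgeFinset.2 (SimpleGraph.edgeSet_mono le_top h1)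

/-! ### Winning positions defined by recursion, and invariants for them. -/

namespace PositionalGame

variable {α : Type*} [DecidableEq α]

/-! Maker has a plan of exactly `m = (k - 1) n / k` claims, all of them edges of the final factor.
Every winning set has `m` edges (`IsPathFactor.card_edges`), so `⌈m / a⌉` rounds are optimal. Red,
playing the same plan, finishes while Blue still holds fewer than `m` edges
(`redWinsStrong_of_winsIn`). By `WinsMidMove.of_invariant` the plan is checked claim by claim.

For `k ≥ 3` Maker builds `a + 3` reserved paths on `k - 1` vertices, then complete paths one at a
time by extending the current end, and finally joins the last `a + 3` isolated vertices to the
reserved paths. A reserved path has two ends, so two Breaker edges are needed to block it from a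
vertex, and each joining claim disposes of two such edges or of all (`exists_entry_le_one`).

In the middle phase only Breaker edges that meet the isolated vertices `U`, and run inside `U`, the
reserved ends and the current end, can hurt. Their number, corrected by a bonus, is the danger. Each
extension lowers it by one as long as it exceeds 2 (`exists_danger_lt`), so the `a` claims of a move
offset the `a` edges of Breaker's reply. Choosing the first vertex of a path lowers it once more
without costing an edge. For large `n` there are enough complete paths for these free steps to
recover what Breaker gained during the reserved phase.

For `k = 2` a reserved path would have a single end. Maker instead claims disjoint edges, each
meeting two live Breaker edges or all of them (`exists_pair_not_mem`). This fails only if Breaker is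
to move with one edge missing, which cannot happen for `a ≥ 2`. -/

/-- Maker, who is to move, holds `M` against Breaker's `B` and can occupy a winning set within her
next `t` moves, both players having bias `a`. -/
def WinsIn (G : PositionalGame α) (a : ℕ) : ℕ → Finset α → Finset α → Prop
  | 0, M, _ => G.Occupies M
  | t + 1, M, B => ∃ S ⊆ G.board, S.card ≤ a ∧ Disjoint S B ∧
      ∀ T ⊆ G.board, T.card ≤ a → Disjoint T (M ∪ S) → G.WinsIn a t (M ∪ S) (B ∪ T)

/-- Maker may still claim `s` elements in her current move, and has `t` further moves. -/
def WinsMidMove (G : PositionalGame α) (a s t : ℕ) (M B : Finset α) : Prop :=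
  ∃ S ⊆ G.board, S.card ≤ s ∧ Disjoint S B ∧
    ∀ T ⊆ G.board, T.card ≤ a → Disjoint T (M ∪ S) → G.WinsIn a t (M ∪ S) (B ∪ T)

variable {G : PositionalGame α} {a b : ℕ}

lemma Occupies.mono {C D : Finset α} (h : G.Occupies C) (hCD : C ⊆ D) : G.Occupies D := by
  obtain ⟨F, hF, hFC⟩ := h
  exact ⟨F, hF, hFC.trans hCD⟩

lemma WinsIn.mono {t : ℕ} {M M' B : Finset α} (h : G.WinsIn a t M B) (hM : M ⊆ M') :
    G.WinsIn a t M' B := by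
  induction t generalizing M M' B with
  | zero => exact Occupies.mono h hM
  | succ t ih =>
    obtain ⟨S, hS, hSa, hSB, h⟩ := h
    refine ⟨S, hS, hSa, hSB, fun T hT hTa hTM => ih (h T hT hTa ?_) ?_⟩
    · exact hTM.mono_right (Finset.union_subset_union_left hM)
    · exact Finset.union_subset_union_left hM

lemma WinsIn.of_occupies {t : ℕ} {M B : Finset α} (h : G.Occupies M) : G.WinsIn a t M B := by
  induction t generalizing M B with
  | zero => exact h
  | succ t ih => exact ⟨∅, by simp, by simp, by simp, fun T _ _ _ => ih (by simpa using h)⟩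

lemma WinsMidMove.winsIn {s t : ℕ} {M B : Finset α} (h : G.WinsMidMove a s t M B) (hs : s ≤ a) :
    G.WinsIn a (t + 1) M B := by
  obtain ⟨S, hS, hSa, hSB, h⟩ := h
  exact ⟨S, hS, hSa.trans hs, hSB, h⟩

lemma WinsMidMove.of_insert {s t : ℕ} {M B : Finset α} {e : α} (he : e ∈ G.board) (heB : e ∉ B)
    (h : G.WinsMidMove a s t (insert e M) B) : G.WinsMidMove a (s + 1) t M B := by
  obtain ⟨S, hS, hSa, hSB, h⟩ := h
  refine ⟨insert e S, Finset.insert_subset he hS, (Finset.card_insert_le _ _).trans (by omega),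
    Finset.disjoint_insert_left.2 ⟨heB, hSB⟩, ?_⟩
  have : M ∪ insert e S = insert e M ∪ S := by ext; simp
  rw [this]
  exact h

lemma WinsMidMove.of_winsIn {t : ℕ} {M B : Finset α}
    (h : ∀ T ⊆ G.board, T.card ≤ a → Disjoint T M → G.WinsIn a t M (B ∪ T)) :
    G.WinsMidMove a 0 t M B :=
  ⟨∅, by simp, by simp, by simp, by simpa using h⟩

/-- An invariant `I s m M B`, where Maker may claim `s` more elements in her current move and `m`
elements until the end of the game, shows that Maker wins if she can keep it and if it implies at
`m = 0` that she occupies a winning set. -/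
theorem WinsMidMove.of_invariant (I : ℕ → ℕ → Finset α → Finset α → Prop)
    (claim : ∀ s m M B, s + 1 ≤ a → (∃ t, m = s + a * t) → B ⊆ G.board → I (s + 1) (m + 1) M B →
      ∃ e ∈ G.board, e ∉ B ∧ I s m (insert e M) B)
    (reply : ∀ m M B T, 0 < m → B ⊆ G.board → T ⊆ G.board → T.card ≤ a → I 0 m M B →
      I a m M (B ∪ T))
    (finish : ∀ s M B, I s 0 M B → G.Occupies M)
    {s t m : ℕ} {M B : Finset α} (hB : B ⊆ G.board) (hs : s ≤ a) (hm : m = s + a * t)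
    (h : I s m M B) : G.WinsMidMove a s t M B := by
  induction t generalizing s m M B with
  | zero =>
    induction s generalizing m M B with
    | zero =>
      subst hm
      exact WinsMidMove.of_winsIn fun T _ _ _ => WinsIn.of_occupies (finish _ _ _ h)
    | succ s ih =>
      obtain ⟨m, rfl⟩ : ∃ m', m = m' + 1 := ⟨s, by simpa using hm⟩
      obtain ⟨e, he, heB, h'⟩ := claim s m M B hs ⟨0, by omega⟩ hB h
      exact (ih hB (by omega) (by omega) h').of_insert he heB
  | succ t iht =>
    induction s generalizing m M B with
    | zero =>
      rcases Nat.eq_zero_or_pos m with rfl | hm0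
      · exact WinsMidMove.of_winsIn fun T _ _ _ => WinsIn.of_occupies (finish _ _ _ h)
      · refine WinsMidMove.of_winsIn fun T hT hTa _ => WinsMidMove.winsIn ?_ le_rfl
        exact iht (Finset.union_subset hB hT) le_rfl (by rw [hm]; ring)
          (reply m M B T hm0 hB hT hTa h)
    | succ s ih =>
      obtain ⟨m, rfl⟩ : ∃ m', m = m' + 1 := ⟨s + a * (t + 1), by omega⟩
      obtain ⟨e, he, heB, h'⟩ := claim s m M B hs ⟨t + 1, by omega⟩ hB h
      exact (ih hB (by omega) (by omega) h').of_insert he heB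

/-! ### From winning positions to strategies. -/

/-- A move of legal size which is a winning continuation whenever there is one. -/
lemma exists_good_move (G : PositionalGame α) (a t : ℕ) (M B : Finset α) :
    ∃ X ⊆ G.board \ (M ∪ B), X.card = min a (G.board \ (M ∪ B)).card ∧
      (G.WinsIn a (t + 1) M B → ∀ T ⊆ G.board, T.card ≤ a → Disjoint T (M ∪ X) →
        G.WinsIn a t (M ∪ X) (B ∪ T)) := by
  by_cases h : G.WinsIn a (t + 1) M B
  · obtain ⟨S, hS, hSa, hSB, hw⟩ := h
    -- A move in `WinsIn` may be short or overlap `M`. Removing the overlap and padding with free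
    -- elements makes it legal, and extra elements do no harm.
    have hsub : S \ M ⊆ G.board \ (M ∪ B) := by
      intro x hx
      simp only [Finset.mem_sdiff, Finset.mem_union, not_or] at hx ⊢
      exact ⟨hS hx.1, hx.2, Finset.disjoint_left.1 hSB hx.1⟩
    obtain ⟨X, hSX, hX, hc⟩ := Finset.exists_subsuperset_card_eq hsub
      (n := min a (G.board \ (M ∪ B)).card)
      (le_min ((Finset.card_le_card Finset.sdiff_subset).trans hSa) (Finset.card_le_card hsub))
      (min_le_right _ _)
    have hMS : M ∪ S ⊆ M ∪ X := by
      intro x hx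
      by_cases hxM : x ∈ M
      · exact Finset.mem_union_left _ hxM
      · exact Finset.mem_union_right _ (hSX (by simp_all))
    exact ⟨X, hX, hc, fun _ T hT hTa hd => (hw T hT hTa (hd.mono_right hMS)).mono hMS⟩
  · obtain ⟨X, hX, hc⟩ := Finset.exists_subset_card_eq (min_le_right a (G.board \ (M ∪ B)).card)
    exact ⟨X, hX, hc, fun h' => absurd h' h⟩

lemma length_play (σ : G.Strategy a) (τ : G.Strategy b) (i : ℕ) : (play σ τ i).length = i := by
  induction i with
  | zero => rfl
  | succ i ih => simp [play, ih]

lemma firstClaims_play_succ (σ : G.Strategy a) (τ : G.Strategy b) (i : ℕ) :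
    firstClaims (play σ τ (i + 1)) = if Even i then firstClaims (play σ τ i) ∪ σ.move (play σ τ i)
      else firstClaims (play σ τ i) := by
  rw [play, firstClaims, length_play]
  split_ifs <;> rfl

lemma secondClaims_play_succ (σ : G.Strategy a) (τ : G.Strategy b) (i : ℕ) :
    secondClaims (play σ τ (i + 1)) = if Even i then secondClaims (play σ τ i)
      else secondClaims (play σ τ i) ∪ τ.move (play σ τ i) := by
  rw [play, secondClaims, length_play]
  split_ifs <;> rfl

lemma card_secondClaims_play_le (σ : G.Strategy a) (τ : G.Strategy b) (t : ℕ) :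
    (secondClaims (play σ τ (2 * t))).card ≤ b * t := by
  induction t with
  | zero => simp [play, secondClaims]
  | succ t ih =>
    rw [show 2 * (t + 1) = 2 * t + 1 + 1 by ring, secondClaims_play_succ, if_neg (by simp),
      secondClaims_play_succ, if_pos (by simp)]
    refine (Finset.card_union_le _ _).trans ?_
    rw [τ.card_move, mul_add, mul_one]
    exact add_le_add ih (min_le_left _ _)

lemma Strategy.move_subset_board (σ : G.Strategy a) (h : List (Finset α)) : σ.move h ⊆ G.board :=
  (σ.move_subset h).trans Finset.sdiff_subset

lemma Strategy.card_move_le (σ : G.Strategy a) (h : List (Finset α)) : (σ.move h).card ≤ a :=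
  (σ.card_move h).trans_le (min_le_left _ _)

lemma exists_strategy (G : PositionalGame α) (a : ℕ) : Nonempty (G.Strategy a) := by
  choose X hX using fun h : List (Finset α) =>
    Finset.exists_subset_card_eq (min_le_right a (G.free h).card)
  exact ⟨⟨X, fun h => (hX h).1, fun h => (hX h).2⟩⟩

theorem makerWinsWithin_of_winsIn {t : ℕ}
    (h : ∀ T ⊆ G.board, T.card ≤ a → G.WinsIn a t ∅ T) : G.MakerWinsWithin a a t := by
  choose X hX hXc hXw using G.exists_good_move a
  let μ : G.Strategy a :=
    -- After `i` full rounds Maker sees a history of length `2 * i + 1`, and her move leaves her `t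
    -- - 1 - i` more.
    { move := fun h => X (t - 1 - h.length / 2) (secondClaims h) (firstClaims h)
      move_subset := fun h => by rw [free, Finset.union_comm]; exact hX _ _ _
      card_move := fun h => by rw [free, Finset.union_comm]; exact hXc _ _ _ }
  refine ⟨μ, fun β => ?_⟩
  have key : ∀ i ≤ t, G.WinsIn a (t - i) (secondClaims (play β μ (2 * i)))
      (firstClaims (play β μ (2 * i)) ∪ β.move (play β μ (2 * i))) := by
    intro i
    induction i with
    | zero =>
      intro _
      simpa [play, secondClaims, firstClaims] using
        h _ (β.move_subset_board []) (β.card_move_le [])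
    | succ i ih =>
      intro hi
      have hw := ih (by omega)
      rw [show t - i = t - (i + 1) + 1 by omega] at hw
      have h1 : firstClaims (play β μ (2 * i + 1)) =
          firstClaims (play β μ (2 * i)) ∪ β.move (play β μ (2 * i)) := by
        rw [firstClaims_play_succ, if_pos (by simp)]
      have h2 : secondClaims (play β μ (2 * i + 1)) = secondClaims (play β μ (2 * i)) := by
        rw [secondClaims_play_succ, if_pos (by simp)]
      have h3 : firstClaims (play β μ (2 * (i + 1))) = firstClaims (play β μ (2 * i + 1)) := by
        rw [show 2 * (i + 1) = 2 * i + 1 + 1 by ring, firstClaims_play_succ, if_neg (by simp)]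
      have h4 : secondClaims (play β μ (2 * (i + 1))) = secondClaims (play β μ (2 * i + 1)) ∪
          X (t - (i + 1)) (secondClaims (play β μ (2 * i + 1)))
            (firstClaims (play β μ (2 * i + 1))) := by
        rw [show 2 * (i + 1) = 2 * i + 1 + 1 by ring, secondClaims_play_succ, if_neg (by simp)]
        simp only [μ, length_play]
        rw [show t - 1 - (2 * i + 1) / 2 = t - (i + 1) by omega]
      rw [← h1, ← h2] at hw
      rw [h3, h4]
      refine hXw _ _ _ hw _ (β.move_subset_board _) (β.card_move_le _) ?_
      rw [← h4]
      refine Finset.disjoint_of_subset_left (β.move_subset _) ?_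
      rw [free]
      exact Finset.disjoint_of_subset_right Finset.subset_union_right Finset.sdiff_disjoint
  have := key t le_rfl
  rw [Nat.sub_self] at this
  exact this

/-- When Red has made `t + 1` moves, Blue has made only `t` and holds at most `a * t` elements, too
few for a winning set. -/
theorem redWinsStrong_of_winsIn {t : ℕ} (h : G.WinsIn a (t + 1) ∅ ∅)
    (hcard : ∀ F ∈ G.winning, a * t < F.card) : G.RedWinsStrong a := by
  choose X hX hXc hXw using G.exists_good_move a
  let ρ : G.Strategy a :=
    { move := fun h => X (t - h.length / 2) (firstClaims h) (secondClaims h)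
      move_subset := fun h => hX _ _ _
      card_move := fun h => hXc _ _ _ }
  refine ⟨ρ, fun β => ⟨2 * t + 1, ?_, ?_⟩⟩
  · have key : ∀ i ≤ t + 1, G.WinsIn a (t + 1 - i) (firstClaims (play ρ β (2 * i)))
        (secondClaims (play ρ β (2 * i))) := by
      intro i
      induction i with
      | zero => intro _; simpa [play, secondClaims, firstClaims] using h
      | succ i ih =>
        intro hi
        have hw := ih (by omega)
        rw [show t + 1 - i = t + 1 - (i + 1) + 1 by omega] at hw
        have h1 : firstClaims (play ρ β (2 * i + 1)) = firstClaims (play ρ β (2 * i)) ∪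
            X (t + 1 - (i + 1)) (firstClaims (play ρ β (2 * i)))
              (secondClaims (play ρ β (2 * i))) := by
          rw [firstClaims_play_succ, if_pos (by simp)]
          simp only [ρ, length_play]
          rw [show t - 2 * i / 2 = t + 1 - (i + 1) by omega]
        have h2 : secondClaims (play ρ β (2 * i + 1)) = secondClaims (play ρ β (2 * i)) := by
          rw [secondClaims_play_succ, if_pos (by simp)]
        have h3 : firstClaims (play ρ β (2 * (i + 1))) = firstClaims (play ρ β (2 * i + 1)) := by
          rw [show 2 * (i + 1) = 2 * i + 1 + 1 by ring, firstClaims_play_succ, if_neg (by simp)]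
        have h4 : secondClaims (play ρ β (2 * (i + 1))) = secondClaims (play ρ β (2 * i)) ∪
            β.move (play ρ β (2 * i + 1)) := by
          rw [show 2 * (i + 1) = 2 * i + 1 + 1 by ring, secondClaims_play_succ, if_neg (by simp),
            h2]
        rw [h3, h4, h1]
        refine hXw _ _ _ hw _ (β.move_subset_board _) (β.card_move_le _) ?_
        rw [← h1]
        refine Finset.disjoint_of_subset_left (β.move_subset _) ?_
        rw [free]
        exact Finset.disjoint_of_subset_right Finset.subset_union_left Finset.sdiff_disjoint
    have hocc := key (t + 1) le_rfl
    rw [Nat.sub_self, show 2 * (t + 1) = 2 * t + 1 + 1 by ring, firstClaims_play_succ,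
      if_neg (by simp)] at hocc
    exact hocc
  · rintro ⟨F, hF, hsub⟩
    have h1 := Finset.card_le_card hsub
    rw [secondClaims_play_succ, if_pos (by simp)] at h1
    have h2 := card_secondClaims_play_le ρ β t
    have h3 := hcard F hF
    omega

/-- Source of the lower bound on the duration: one arbitrary play already forces it. -/
lemma MakerWinsWithin.exists_card_le {t : ℕ} (h : G.MakerWinsWithin a b t) :
    ∃ F ∈ G.winning, F.card ≤ a * t := by
  obtain ⟨μ, hμ⟩ := h
  obtain ⟨β⟩ := G.exists_strategy b
  obtain ⟨F, hF, hsub⟩ := hμ β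
  exact ⟨F, hF, (Finset.card_le_card hsub).trans (card_secondClaims_play_le β μ t)⟩

lemma duration_eq {t : ℕ} (ht : G.MakerWinsWithin a b t)
    (hle : ∀ t', G.MakerWinsWithin a b t' → t ≤ t') : G.duration a b = t :=
  le_antisymm (iInf₂_le t ht) (le_iInf₂ fun t' h' => by exact_mod_cast hle t' h')

end PositionalGame

/-! ### Path factors in coordinates (component, position on the path). -/

section PathFactor

variable {V C : Type*} {k : ℕ} {H : SimpleGraph V}

lemma IsPathFactor.exists_equiv (h : IsPathFactor k H) :
    ∃ e : H.ConnectedComponent × Fin k ≃ V, ∀ c c' i j,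
      H.Adj (e (c, i)) (e (c', j)) ↔ c = c' ∧ (SimpleGraph.pathGraph k).Adj i j := by
  have φ := fun c : H.ConnectedComponent => (h c).some
  have hmem : ∀ c i, H.connectedComponentMk ((φ c).symm i : V) = c := fun c i =>
    ((φ c).symm i).2
  have hbij : Function.Bijective
      (fun x : H.ConnectedComponent × Fin k => ((φ x.1).symm x.2 : V)) := by
    constructor
    · rintro ⟨c, i⟩ ⟨c', j⟩ hij
      have hij' : ((φ c).symm i : V) = ((φ c').symm j : V) := hij
      obtain rfl : c = c' := by rw [← hmem c i, ← hmem c' j, hij']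
      have := (φ c).symm.injective (Subtype.ext hij')
      rw [this]
    · intro v
      refine ⟨(H.connectedComponentMk v, φ _ ⟨v, rfl⟩), ?_⟩
      simp
  refine ⟨Equiv.ofBijective _ hbij, fun c c' i j => ?_⟩
  simp only [Equiv.ofBijective_apply]
  constructor
  · intro hadj
    obtain rfl : c = c' := by
      rw [← hmem c i, ← hmem c' j]
      exact SimpleGraph.ConnectedComponent.sound hadj.reachable
    refine ⟨rfl, ?_⟩
    rw [← (φ c).symm.map_adj_iff]
    exact hadj
  · rintro ⟨rfl, hadj⟩
    rw [← (φ c).symm.map_adj_iff] at hadj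
    exact hadj

/-- Adjacency, hence reachability, preserves the first coordinate, and each fibre is connected as
the image of a path. So the components are the fibres. -/
lemma isPathFactor_of_equiv (e : C × Fin k ≃ V) (he : ∀ c c' i j,
    H.Adj (e (c, i)) (e (c', j)) ↔ c = c' ∧ (SimpleGraph.pathGraph k).Adj i j) :
    IsPathFactor k H := by
  have hreach : ∀ c i j, H.Reachable (e (c, i)) (e (c, j)) := by
    intro c i j
    let f : SimpleGraph.pathGraph k →g H := ⟨fun i => e (c, i), fun h => (he _ _ _ _).2 ⟨rfl, h⟩⟩
    exact (SimpleGraph.pathGraph_preconnected k i j).map f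
  have hsame : ∀ u v, H.Reachable u v → (e.symm u).1 = (e.symm v).1 := by
    rintro u v ⟨w⟩
    induction w with
    | nil => rfl
    | @cons u v w hadj _ ih =>
      rw [← ih]
      have := he (e.symm u).1 (e.symm v).1 (e.symm u).2 (e.symm v).2
      simp only [Prod.mk.eta, Equiv.apply_symm_apply] at this
      exact (this.1 hadj).1
  intro c
  induction c using SimpleGraph.ConnectedComponent.ind with
  | h v =>
  set x := e.symm v with hx
  have hv : e x = v := by simp [hx]
  have hmem : ∀ i, e (x.1, i) ∈ (H.connectedComponentMk v).supp := fun i => by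
    rw [SimpleGraph.ConnectedComponent.mem_supp_iff, SimpleGraph.ConnectedComponent.eq, ← hv]
    exact hreach _ _ _
  have hfst : ∀ u ∈ (H.connectedComponentMk v).supp, (e.symm u).1 = x.1 := fun u hu =>
    hsame u v (SimpleGraph.ConnectedComponent.exact hu)
  refine ⟨⟨⟨fun u => (e.symm u.1).2, fun i => ⟨e (x.1, i), hmem i⟩, ?_, ?_⟩, ?_⟩⟩
  · rintro ⟨u, hu⟩
    apply Subtype.ext
    simp only
    rw [← hfst u hu]
    simp
  · intro i
    simp
  · rintro ⟨u, hu⟩ ⟨w, hw⟩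
    have := he (e.symm u).1 (e.symm w).1 (e.symm u).2 (e.symm w).2
    simp only [Prod.mk.eta, Equiv.apply_symm_apply] at this
    simp only [Equiv.coe_fn_mk, SimpleGraph.ConnectedComponent.toSimpleGraph,
      SimpleGraph.comap_adj, Function.Embedding.subtype_apply, this]
    simp [hfst u hu, hfst w hw]

/-- A `P_k`-factor on `k * N` vertices has `(k - 1) * N` edges. -/
lemma IsPathFactor.card_edges [Fintype V] (h : IsPathFactor k H) (hk : 1 ≤ k) {N : ℕ}
    (hV : Fintype.card V = k * N) {F : Finset (Sym2 V)} (hF : (F : Set (Sym2 V)) = H.edgeSet) :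
    F.card = (k - 1) * N := by
  classical
  obtain ⟨e, he⟩ := h.exists_equiv
  obtain ⟨k, rfl⟩ : ∃ k', k = k' + 1 := ⟨k - 1, by omega⟩
  have : Fintype H.ConnectedComponent := Fintype.ofFinite _
  have hC : Fintype.card H.ConnectedComponent = N := by
    have := Fintype.card_congr e
    rw [Fintype.card_prod, Fintype.card_fin, hV, mul_comm] at this
    exact Nat.eq_of_mul_eq_mul_left (by omega) this
  -- Each edge is indexed once, by its component and its lower position.
  have himg : F = (Finset.univ : Finset (H.ConnectedComponent × Fin k)).image
      (fun x => s(e (x.1, x.2.castSucc), e (x.1, x.2.succ))) := by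
    ext s
    rw [← Finset.mem_coe, hF]
    induction s using Sym2.ind with
    | h u v =>
    rw [SimpleGraph.mem_edgeSet]
    obtain ⟨⟨c, i⟩, rfl⟩ := e.surjective u
    obtain ⟨⟨c', j⟩, rfl⟩ := e.surjective v
    rw [he]
    simp only [Finset.mem_image, Finset.mem_univ, true_and, Prod.exists, Sym2.eq_iff,
      EmbeddingLike.apply_eq_iff_eq, Prod.mk.injEq, SimpleGraph.pathGraph_adj]
    constructor
    · rintro ⟨rfl, hij | hij⟩
      · exact ⟨c, ⟨i, by omega⟩, Or.inl ⟨⟨rfl, rfl⟩, rfl, Fin.ext (by simp [hij])⟩⟩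
      · exact ⟨c, ⟨j, by omega⟩, Or.inr ⟨⟨rfl, rfl⟩, rfl, Fin.ext (by simp [hij])⟩⟩
    · rintro ⟨d, l, ⟨⟨rfl, rfl⟩, rfl, rfl⟩ | ⟨⟨rfl, rfl⟩, rfl, rfl⟩⟩
      · simp
      · simp
  rw [himg, Finset.card_image_of_injective, Finset.card_univ, Fintype.card_prod, hC,
    Fintype.card_fin, Nat.add_sub_cancel, mul_comm]
  rintro ⟨c, i⟩ ⟨d, j⟩ hij
  simp only [Sym2.eq_iff, EmbeddingLike.apply_eq_iff_eq, Prod.mk.injEq, Fin.ext_iff,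
    Fin.val_castSucc, Fin.val_succ] at hij
  rcases hij with ⟨⟨h1, h2⟩, -⟩ | ⟨⟨h1, h2⟩, -, h3⟩
  · exact Prod.ext h1 (Fin.ext h2)
  · omega

/-- Consecutive vertices of `l` are joined by edges in `M`. -/
def IsTrailIn (M : Finset (Sym2 V)) (l : List V) : Prop := l.IsChain fun x y => s(x, y) ∈ M

lemma IsTrailIn.mono {M M' : Finset (Sym2 V)} {l : List V} (h : IsTrailIn M l) (hM : M ⊆ M') :
    IsTrailIn M' l :=
  List.IsChain.imp (fun _ _ hxy => hM hxy) h

lemma IsTrailIn.reverse {M : Finset (Sym2 V)} {l : List V} (h : IsTrailIn M l) :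
    IsTrailIn M l.reverse := by
  rw [IsTrailIn, List.isChain_reverse]
  exact List.IsChain.imp (fun x y hxy => by rwa [Sym2.eq_swap]) h

/-- Paths with `k` vertices which partition the vertex set form a `P_k`-factor. -/
lemma exists_isPathFactor_of_trails [Fintype V] {M : Finset (Sym2 V)} {F : Multiset (List V)}
    (hF : ∀ l ∈ F, l.length = k ∧ IsTrailIn M l)
    (hcov : F.bind Multiset.ofList = Finset.univ.val) :
    ∃ H : SimpleGraph V, IsPathFactor k H ∧ H.edgeSet ⊆ M := by
  classical
  obtain ⟨L, rfl⟩ : ∃ L : List (List V), (L : Multiset (List V)) = F := Quot.exists_rep F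
  have hL : ∀ i : Fin L.length, (L.get i).length = k ∧ IsTrailIn M (L.get i) := fun i =>
    hF _ (by simp)
  let f : Fin L.length × Fin k → V := fun x => (L.get x.1).get (x.2.cast (hL x.1).1.symm)
  -- With equal cardinalities, surjectivity of `f` is enough for a bijection.
  have hcard : Fintype.card (Fin L.length × Fin k) = Fintype.card V := by
    have h1 : (Finset.univ : Finset V).val.card = Fintype.card V := rfl
    rw [← h1, ← hcov]
    rw [Multiset.card_bind, Multiset.map_congr rfl (g := fun _ => k)
      fun l hl => by simp [(hF l hl).1]]
    simp
  have hsurj : Function.Surjective f := by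
    intro v
    have hv : v ∈ (Finset.univ : Finset V).val := Finset.mem_univ v
    rw [← hcov, Multiset.mem_bind] at hv
    obtain ⟨l, hl, hv⟩ := hv
    obtain ⟨i, rfl⟩ := List.mem_iff_get.1 (Multiset.mem_coe.1 hl)
    obtain ⟨j, rfl⟩ := List.mem_iff_get.1 (Multiset.mem_coe.1 hv)
    exact ⟨(i, j.cast (hL i).1), rfl⟩
  let e : Fin L.length × Fin k ≃ V :=
    Equiv.ofBijective f ((Fintype.bijective_iff_surjective_and_card f).2 ⟨hsurj, hcard⟩)
  let H : SimpleGraph V :=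
    { Adj := fun x y => (e.symm x).1 = (e.symm y).1 ∧
        (SimpleGraph.pathGraph k).Adj (e.symm x).2 (e.symm y).2
      symm := ⟨fun x y h => ⟨h.1.symm, h.2.symm⟩⟩
      loopless := ⟨fun x h => h.2.ne rfl⟩ }
  refine ⟨H, isPathFactor_of_equiv e fun c c' i j => by simp [H], ?_⟩
  intro s
  induction s using Sym2.ind with
  | h u v =>
  obtain ⟨⟨c, i⟩, rfl⟩ := e.surjective u
  obtain ⟨⟨c', j⟩, rfl⟩ := e.surjective v
  rw [SimpleGraph.mem_edgeSet]
  rintro ⟨h1, h2⟩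
  simp only [Equiv.symm_apply_apply] at h1 h2
  subst h1
  have hch := List.isChain_iff_getElem.1 (hL c).2
  rcases SimpleGraph.pathGraph_adj.1 h2 with h | h
  · have := hch i (by rw [(hL c).1]; omega)
    simpa [e, f, ← h] using this
  · have := hch j (by rw [(hL c).1]; omega)
    rw [Sym2.eq_swap]
    simpa [e, f, ← h] using this

end PathFactor

/-! ### The danger potential. -/

section LiveEdges

variable {V : Type*} [DecidableEq V]

open Classical in
/-- The edges of `B` inside `U ∪ X` that meet `U`. -/
noncomputable def liveEdges (B : Finset (Sym2 V)) (U X : Finset V) : Finset (Sym2 V) :=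
  B.filter fun s => (∃ x ∈ U, x ∈ s) ∧ ∀ x ∈ s, x ∈ U ∪ X

open Classical in
/-- The vertices of `U` with a `B`-neighbour in `X`. -/
noncomputable def nbrs (B : Finset (Sym2 V)) (U X : Finset V) : Finset V :=
  U.filter fun y => ∃ x ∈ X, s(x, y) ∈ B

/-- The number of live edges, plus a bonus of one if `U` has no `B`-neighbour of `O` and no vertex
of `U` has more than one `B`-neighbour in `R`. -/
noncomputable def danger (B : Finset (Sym2 V)) (U R O : Finset V) : ℕ :=
  (liveEdges B U (R ∪ O)).card +
    if nbrs B U O = ∅ ∧ ∀ w ∈ U, (nbrs B R {w}).card ≤ 1 then 1 else 0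

variable {B T : Finset (Sym2 V)} {U R O : Finset V}

lemma mem_liveEdges {X : Finset V} {s : Sym2 V} :
    s ∈ liveEdges B U X ↔ s ∈ B ∧ (∃ x ∈ U, x ∈ s) ∧ ∀ x ∈ s, x ∈ U ∪ X := by
  simp only [liveEdges, Finset.mem_filter]

lemma mem_nbrs {X : Finset V} {y : V} : y ∈ nbrs B U X ↔ y ∈ U ∧ ∃ x ∈ X, s(x, y) ∈ B := by
  rw [nbrs, Finset.mem_filter]

lemma mem_nbrs_singleton {y w : V} : y ∈ nbrs B U {w} ↔ y ∈ U ∧ s(w, y) ∈ B := by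
  simp [nbrs]

lemma nbrs_empty : nbrs B U ∅ = ∅ := by simp [nbrs]

lemma card_liveEdges_union_le (X : Finset V) :
    (liveEdges (B ∪ T) U X).card ≤ (liveEdges B U X).card + T.card := by
  classical
  simp only [liveEdges, Finset.filter_union]
  exact (Finset.card_union_le _ _).trans (add_le_add le_rfl (Finset.card_filter_le _ _))

lemma nbrs_mono (X : Finset V) (h : B ⊆ T) : nbrs B U X ⊆ nbrs T U X := fun y hy => by
  rw [mem_nbrs] at hy ⊢
  obtain ⟨hy, x, hx, hxy⟩ := hy
  exact ⟨hy, x, hx, h hxy⟩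

/-- New edges can destroy the bonus but never create it. -/
lemma danger_union_le : danger (B ∪ T) U R O ≤ danger B U R O + T.card := by
  have h1 := card_liveEdges_union_le (B := B) (T := T) (U := U) (R ∪ O)
  have h2 : (if nbrs (B ∪ T) U O = ∅ ∧ ∀ w ∈ U, (nbrs (B ∪ T) R {w}).card ≤ 1 then 1 else 0) ≤
      if nbrs B U O = ∅ ∧ ∀ w ∈ U, (nbrs B R {w}).card ≤ 1 then 1 else 0 := by
    split_ifs with h h'
    · exact le_rfl
    · refine absurd ⟨?_, fun w hw => ?_⟩ h'
      · exact Finset.subset_empty.1 (h.1 ▸ nbrs_mono O Finset.subset_union_left)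
      · exact (Finset.card_le_card (nbrs_mono _ Finset.subset_union_left)).trans (h.2 w hw)
    · exact Nat.zero_le _
    · exact le_rfl
  unfold danger
  omega

lemma exists_crossing_edges {X : Finset V} (hUX : Disjoint U X) :
    ∃ D ⊆ B, D.card = (nbrs B U X).card ∧ ∀ s ∈ D, ∃ x ∈ X, ∃ y ∈ U, s = s(x, y) := by
  choose! g hg using fun y (hy : y ∈ nbrs B U X) => (mem_nbrs.1 hy).2
  refine ⟨(nbrs B U X).image fun y => s(g y, y), ?_, Finset.card_image_of_injOn ?_, ?_⟩
  · intro s hs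
    obtain ⟨y, hy, rfl⟩ := Finset.mem_image.1 hs
    exact (hg y hy).2
  · intro y hy z hz hyz
    rcases Sym2.eq_iff.1 hyz with ⟨-, h⟩ | ⟨h, -⟩
    · exact h
    · exact absurd (hg y hy).1 (h ▸ Finset.disjoint_left.1 hUX (mem_nbrs.1 hz).1)
  · intro s hs
    obtain ⟨y, hy, rfl⟩ := Finset.mem_image.1 hs
    exact ⟨g y, (hg y hy).1, y, (mem_nbrs.1 hy).1, rfl⟩

lemma card_liveEdges_drop (hUO : Disjoint U O) (hRO : Disjoint R O) :
    (liveEdges B U R).card + (nbrs B U O).card ≤ (liveEdges B U (R ∪ O)).card := by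
  obtain ⟨D, hDB, hD, hDe⟩ := exists_crossing_edges (B := B) hUO
  rw [← hD, ← Finset.card_union_of_disjoint]
  · refine Finset.card_le_card fun s hs => ?_
    rw [mem_liveEdges]
    rcases Finset.mem_union.1 hs with h | h
    · obtain ⟨h1, h2, h3⟩ := mem_liveEdges.1 h
      refine ⟨h1, h2, fun x hx => ?_⟩
      have := h3 x hx
      simp only [Finset.mem_union] at this ⊢
      tauto
    · obtain ⟨x, hx, y, hy, rfl⟩ := hDe s h
      exact ⟨hDB h, ⟨y, hy, by simp⟩, by simp [hx, hy]⟩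
  · rw [Finset.disjoint_left]
    intro s hs hsD
    obtain ⟨x, hx, y, hy, rfl⟩ := hDe s hsD
    rcases Finset.mem_union.1 ((mem_liveEdges.1 hs).2.2 x (by simp)) with h | h
    · exact Finset.disjoint_left.1 hUO h hx
    · exact Finset.disjoint_left.1 hRO h hx

/-- Moving a vertex `w` from `U` to the second class kills the edges between `w` and `R`. -/
lemma card_liveEdges_move_le (hUR : Disjoint U R) {w : V} (hw : w ∈ U) :
    (liveEdges B (U.erase w) (R ∪ {w})).card + (nbrs B R {w}).card ≤ (liveEdges B U R).card := by
  obtain ⟨D, hDB, hD, hDe⟩ := exists_crossing_edges (B := B) (U := R) (X := {w})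
    (Finset.disjoint_singleton_right.2 (Finset.disjoint_left.1 hUR hw))
  rw [← hD, ← Finset.card_union_of_disjoint]
  · refine Finset.card_le_card fun s hs => ?_
    rw [mem_liveEdges]
    rcases Finset.mem_union.1 hs with h | h
    · obtain ⟨h1, ⟨x, hx, hxs⟩, h3⟩ := mem_liveEdges.1 h
      refine ⟨h1, ⟨x, Finset.mem_of_mem_erase hx, hxs⟩, fun x hx => ?_⟩
      have := h3 x hx
      simp only [Finset.mem_union, Finset.mem_erase, Finset.mem_singleton] at this ⊢
      rcases this with h | h | rfl <;> tauto
    · obtain ⟨x, hx, y, hy, rfl⟩ := hDe s h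
      rw [Finset.mem_singleton] at hx
      subst hx
      exact ⟨hDB h, ⟨x, hw, by simp⟩, by simp [hw, hy]⟩
  · rw [Finset.disjoint_left]
    intro s hs hsD
    obtain ⟨x, hx, y, hy, rfl⟩ := hDe s hsD
    rw [Finset.mem_singleton] at hx
    obtain ⟨-, ⟨z, hz, hzs⟩, -⟩ := mem_liveEdges.1 hs
    rcases Sym2.mem_iff.1 hzs with rfl | rfl
    · exact (Finset.ne_of_mem_erase hz) hx
    · exact Finset.disjoint_left.1 hUR (Finset.mem_of_mem_erase hz) hy

/-- Giving up `O` can create the bonus only if `O` had a neighbour in `U`, and then a live edge dies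
with it. -/
lemma danger_drop_le (hUO : Disjoint U O) (hRO : Disjoint R O) :
    danger B U R ∅ ≤ danger B U R O := by
  have h := card_liveEdges_drop (B := B) hUO hRO
  unfold danger
  rw [nbrs_empty, Finset.union_empty]
  rcases Finset.eq_empty_or_nonempty (nbrs B U O) with h0 | h0
  · rw [h0] at h ⊢
    simp only [Finset.card_empty] at h
    omega
  · have := h0.card_pos
    rw [if_neg (c := nbrs B U O = ∅ ∧ _) (fun h' => h0.ne_empty h'.1)]
    split_ifs <;> omega

/-- Unless the danger is small, some vertex `w` of `U` which is not a `B`-neighbour of `O` can take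
over the role of `O` and lower the danger. -/
theorem exists_danger_lt (hB : ∀ v, s(v, v) ∉ B) (hUO : Disjoint U O) (hRO : Disjoint R O)
    (hUR : Disjoint U R) (hN : (nbrs B U O).card < U.card) :
    ∃ w ∈ U, w ∉ nbrs B U O ∧
      danger B (U.erase w) R {w} ≤ max (danger B U R O - 1) 2 := by
  -- Replacing `O` by `w` kills the edges from `O` to `U` and from `w` to `R`; those from `w` to `U`
  -- stay live. The bonus pays for a step that kills nothing.
  have hdrop := card_liveEdges_drop (B := B) hUO hRO
  have hmove := fun w hw => card_liveEdges_move_le (B := B) hUR (w := w) hw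
  have hE : (liveEdges B U (R ∪ O)).card ≤ danger B U R O := Nat.le_add_right _ _
  have hE1 : nbrs B U O = ∅ → (∀ w ∈ U, (nbrs B R {w}).card ≤ 1) →
      (liveEdges B U (R ∪ O)).card + 1 = danger B U R O := fun h h' => by
    rw [danger, if_pos ⟨h, h'⟩]
  have hle : ∀ w, danger B (U.erase w) R {w} ≤ (liveEdges B (U.erase w) (R ∪ {w})).card + 1 :=
    fun w => by
      unfold danger
      split_ifs <;> omega
  -- A neighbour of `w` in `U` is a neighbour of the new end, which rules out the bonus.
  have heq : ∀ w, (nbrs B U {w}).Nonempty →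
      danger B (U.erase w) R {w} = (liveEdges B (U.erase w) (R ∪ {w})).card := by
    rintro w ⟨y, hy⟩
    rw [danger, if_neg, add_zero]
    rintro ⟨h, -⟩
    rw [mem_nbrs_singleton] at hy
    have : y ∈ nbrs B (U.erase w) {w} := by
      refine mem_nbrs_singleton.2 ⟨Finset.mem_erase.2 ⟨?_, hy.1⟩, hy.2⟩
      rintro rfl
      exact hB _ hy.2
    simp [h] at this
  by_cases hA : ∃ w ∈ U, w ∉ nbrs B U O ∧ ((nbrs B U {w}).Nonempty ∨ (nbrs B R {w}).Nonempty)
  · rcases Finset.eq_empty_or_nonempty (nbrs B U O) with h0 | h0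
    -- Two killed edges cover a possible new bonus. Otherwise the old danger contains the bonus, and
    -- either it is lost or an edge dies.
    · by_cases h2 : ∃ w ∈ U, 2 ≤ (nbrs B R {w}).card
      · obtain ⟨w, hw, hw2⟩ := h2
        refine ⟨w, hw, by simp [h0], ?_⟩
        have := hmove w hw
        have := hle w
        omega
      · push Not at h2
        have h1 := hE1 h0 fun w hw => by have := h2 w hw; omega
        obtain ⟨w, hw, hwN, hw2⟩ := hA
        refine ⟨w, hw, hwN, ?_⟩
        have := hmove w hw
        rcases hw2 with hw2 | hw2
        · have := heq w hw2
          omega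
        · have := hle w
          have := hw2.card_pos
          omega
    · obtain ⟨w, hw, hwN, hw2⟩ := hA
      refine ⟨w, hw, hwN, ?_⟩
      have := hmove w hw
      have := h0.card_pos
      by_cases hw3 : (nbrs B U {w}).Nonempty
      · have := heq w hw3
        omega
      · have := hle w
        have := (hw2.resolve_left hw3).card_pos
        omega
  -- Now only neighbours of `O` carry live edges inside `U ∪ R`, and any other `w` will do.
  · push Not at hA
    obtain ⟨w, hw, hwN⟩ := Finset.exists_mem_notMem_of_card_lt_card hN
    refine ⟨w, hw, hwN, ?_⟩
    obtain ⟨hwU, hwR⟩ := hA w hw hwN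
    have hmw := hmove w hw
    have hlew := hle w
    -- Such a `w'` is a neighbour of `O`, hence differs from `w`, stays in `U` and prevents the
    -- bonus.
    by_cases h2 : ∃ w' ∈ U, 2 ≤ (nbrs B R {w'}).card
    · obtain ⟨w', hw', hw2⟩ := h2
      have hw'N : w' ∈ nbrs B U O := by
        by_contra h
        rw [(hA w' hw' h).2] at hw2
        simp at hw2
      have hd : danger B (U.erase w) R {w} = (liveEdges B (U.erase w) (R ∪ {w})).card := by
        rw [danger, if_neg, add_zero]
        rintro ⟨-, h⟩
        have := h w' (Finset.mem_erase.2 ⟨fun h' => hwN (h' ▸ hw'N), hw'⟩)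
        omega
      have := Finset.card_pos.2 ⟨w', hw'N⟩
      omega
    · push Not at h2
      rcases Nat.lt_or_ge 1 (nbrs B U O).card with hf | hf
      · omega
      -- A remaining live edge joins the only neighbour of `O` to its only neighbour in `R`.
      -- Together with the bonus this is the 2 in the bound.
      · have hone : (liveEdges B (U.erase w) (R ∪ {w})).card ≤ 1 := by
          have hnbr : ∀ x ∈ U, ∀ y ∈ U ∪ R, s(x, y) ∈ B → x ∈ nbrs B U O := by
            intro x hx y hy hxy
            by_contra h
            obtain ⟨h3, h4⟩ := hA x hx h
            rcases Finset.mem_union.1 hy with hy | hy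
            · have := mem_nbrs_singleton.2 ⟨hy, hxy⟩
              simp [h3] at this
            · have := mem_nbrs_singleton.2 ⟨hy, hxy⟩
              simp [h4] at this
          have hsub : ∀ s ∈ liveEdges B (U.erase w) (R ∪ {w}),
              ∃ x ∈ nbrs B U O, ∃ y ∈ nbrs B R {x}, s = s(x, y) := by
            intro s hs
            obtain ⟨hsB, ⟨x, hx, hxs⟩, hall⟩ := mem_liveEdges.1 hs
            obtain ⟨y, rfl⟩ := Sym2.mem_iff_exists.1 hxs
            have hxU := Finset.mem_of_mem_erase hx
            have hy : y ∈ U ∪ R := by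
              have := hall y (by simp)
              simp only [Finset.mem_union, Finset.mem_erase, Finset.mem_singleton] at this ⊢
              rcases this with h | h | rfl <;> tauto
            have hxN := hnbr x hxU y hy hsB
            rcases Finset.mem_union.1 hy with hyU | hyR
            · have hyN := hnbr y hyU x (Finset.mem_union_left _ hxU) (by rwa [Sym2.eq_swap])
              obtain rfl := Finset.card_le_one.1 hf _ hxN _ hyN
              exact absurd hsB (hB _)
            · exact ⟨x, hxN, y, mem_nbrs_singleton.2 ⟨hyR, hsB⟩, rfl⟩
          rw [Finset.card_le_one]
          intro s hs t ht
          obtain ⟨x, hx, y, hy, rfl⟩ := hsub s hs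
          obtain ⟨x', hx', y', hy', rfl⟩ := hsub t ht
          obtain rfl := Finset.card_le_one.1 hf _ hx _ hx'
          have := h2 x (mem_nbrs.1 hx).1
          rw [Finset.card_le_one.1 (by omega) _ hy _ hy']
        omega

end LiveEdges

/-! ### Counting lemma for joining vertices to reserved paths. -/

/-- In a matrix with entries at most two and total less than twice its size, some entry which is at
most one lies in a row and a column that together contain at least two of the total, or all of
it. -/
lemma exists_entry_le_one {ι κ : Type*} [DecidableEq ι] [DecidableEq κ] {I : Finset ι}
    {W : Finset κ} {N : ℕ} (hI : I.card = N) (hW : W.card = N) (hN : 0 < N) (β : ι → κ → ℕ)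
    (hsum : ∑ w ∈ W, ∑ i ∈ I, β i w < 2 * N) :
    ∃ i ∈ I, ∃ w ∈ W, β i w ≤ 1 ∧
      ∑ w' ∈ W.erase w, ∑ i' ∈ I.erase i, β i' w' ≤ (∑ w ∈ W, ∑ i ∈ I, β i w) - 2 := by
  set S := ∑ w ∈ W, ∑ i ∈ I, β i w with hS
  have hS' : S = ∑ i ∈ I, ∑ w ∈ W, β i w := Finset.sum_comm
  -- Inclusion-exclusion for deleting a row and a column.
  have hkill : ∀ i ∈ I, ∀ w ∈ W, ∑ w' ∈ W.erase w, ∑ i' ∈ I.erase i, β i' w' +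
      ∑ w' ∈ W, β i w' + ∑ i' ∈ I, β i' w = S + β i w := by
    intro i hi w hw
    have h1 : ∀ w', ∑ i' ∈ I.erase i, β i' w' + β i w' = ∑ i' ∈ I, β i' w' := fun w' =>
      Finset.sum_erase_add _ _ hi
    have h2 := Finset.sum_erase_add W (fun w' => ∑ i' ∈ I, β i' w') hw
    have h3 := Finset.sum_erase_add W (fun w' => β i w') hw
    simp only [← h1, Finset.sum_add_distrib] at h2
    simp only [← h1, Finset.sum_add_distrib] at hS
    have h4 := h1 w
    omega
  have hrow : ∀ i ∈ I, ∀ w ∈ W, β i w ≤ ∑ w' ∈ W, β i w' := fun i _ w hw =>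
    Finset.single_le_sum (f := fun w' => β i w') (fun _ _ => Nat.zero_le _) hw
  have hcol : ∀ i ∈ I, ∀ w ∈ W, β i w ≤ ∑ i' ∈ I, β i' w := fun i hi w _ =>
    Finset.single_le_sum (f := fun i' => β i' w) (fun _ _ => Nat.zero_le _) hi
  by_cases h1 : ∃ i ∈ I, 2 ≤ ∑ w ∈ W, β i w
  · obtain ⟨i, hi, hi2⟩ := h1
    have : ∃ w ∈ W, β i w < 2 := by
      apply Finset.exists_lt_of_sum_lt
      have := Finset.single_le_sum (f := fun i => ∑ w ∈ W, β i w) (fun _ _ => Nat.zero_le _) hi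
      rw [Finset.sum_const, hW, smul_eq_mul]
      omega
    obtain ⟨w, hw, hlt⟩ := this
    have := hkill i hi w hw
    have := hcol i hi w hw
    exact ⟨i, hi, w, hw, by omega, by omega⟩
  by_cases h2 : ∃ w ∈ W, 2 ≤ ∑ i ∈ I, β i w
  · obtain ⟨w, hw, hw2⟩ := h2
    have : ∃ i ∈ I, β i w < 2 := by
      apply Finset.exists_lt_of_sum_lt
      have := Finset.single_le_sum (f := fun w => ∑ i ∈ I, β i w) (fun _ _ => Nat.zero_le _) hw
      rw [Finset.sum_const, hI, smul_eq_mul]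
      omega
    obtain ⟨i, hi, hlt⟩ := this
    have := hkill i hi w hw
    have := hrow i hi w hw
    exact ⟨i, hi, w, hw, by omega, by omega⟩
  push Not at h1 h2
  have hle : ∀ i ∈ I, ∀ w ∈ W, β i w ≤ 1 := fun i hi w hw => by
    have := h1 i hi
    have := hrow i hi w hw
    omega
  rcases Nat.eq_zero_or_pos S with h0 | h0
  · obtain ⟨i, hi⟩ := Finset.card_pos.1 (hI ▸ hN)
    obtain ⟨w, hw⟩ := Finset.card_pos.1 (hW ▸ hN)
    have := hkill i hi w hw
    have := hle i hi w hw
    have := hrow i hi w hw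
    exact ⟨i, hi, w, hw, by omega, by omega⟩
  · obtain ⟨i, hi, hi0⟩ : ∃ i ∈ I, ∑ w ∈ W, β i w ≠ 0 :=
      Finset.exists_ne_zero_of_sum_ne_zero (by omega)
    -- Either some column has weight outside the nonzero row `i`, so that row and column kill two,
    -- or row `i` carries the whole total.
    by_cases h3 : ∃ w ∈ W, β i w < ∑ i' ∈ I, β i' w
    · obtain ⟨w, hw, hlt⟩ := h3
      have := hkill i hi w hw
      exact ⟨i, hi, w, hw, hle i hi w hw, by omega⟩
    · push Not at h3
      have := Finset.sum_le_sum h3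
      obtain ⟨w, hw⟩ := Finset.card_pos.1 (hW ▸ hN)
      have := hkill i hi w hw
      have := h1 i hi
      have := hcol i hi w hw
      exact ⟨i, hi, w, hw, hle i hi w hw, by omega⟩

/-! ### Choosing an edge for `k = 2`, and the crossing number. -/

section LiveEdges

variable {V : Type*} [DecidableEq V] {B T : Finset (Sym2 V)} {U R W : Finset V}

lemma card_liveEdges_erase (hB : ∀ v, s(v, v) ∉ B) {v : V} (hv : v ∈ U) :
    (liveEdges B (U.erase v) ∅).card + (nbrs B U {v}).card ≤ (liveEdges B U ∅).card := by
  have h1 := card_liveEdges_move_le (B := B) (Finset.disjoint_empty_right U) hv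
  have h2 := card_liveEdges_drop (B := B) (U := U.erase v) (R := ∅) (O := {v}) (by simp) (by simp)
  have h3 : nbrs B (U.erase v) {v} = nbrs B U {v} := by
    ext y
    simp only [mem_nbrs_singleton, Finset.mem_erase]
    refine ⟨fun h => ⟨h.1.2, h.2⟩, fun h => ⟨⟨?_, h.1⟩, h.2⟩⟩
    rintro rfl
    exact hB _ h.2
  rw [h3] at h2
  omega

/-- As `v` and `z` are not adjacent in `B`, no edge is counted at both. -/
lemma card_liveEdges_erase_erase (hB : ∀ v, s(v, v) ∉ B) {v z : V} (hv : v ∈ U) (hz : z ∈ U)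
    (hzv : z ≠ v) (hvz : s(v, z) ∉ B) :
    (liveEdges B ((U.erase v).erase z) ∅).card + (nbrs B U {v}).card + (nbrs B U {z}).card ≤
      (liveEdges B U ∅).card := by
  have h1 := card_liveEdges_erase hB hv
  have h2 := card_liveEdges_erase hB (Finset.mem_erase.2 ⟨hzv, hz⟩)
  have h3 : nbrs B (U.erase v) {z} = nbrs B U {z} := by
    ext y
    simp only [mem_nbrs_singleton, Finset.mem_erase]
    refine ⟨fun h => ⟨h.1.2, h.2⟩, fun h => ⟨⟨?_, h.1⟩, h.2⟩⟩
    rintro rfl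
    exact hvz (by rw [Sym2.eq_swap]; exact h.2)
  rw [h3] at h2
  omega

/-- If `B` has at most `|U| - 2` edges inside `U`, then some pair outside `B` meets two of them, or
all of them. -/
lemma exists_pair_not_mem (hB : ∀ v, s(v, v) ∉ B) (hU : (liveEdges B U ∅).card + 2 ≤ U.card) :
    ∃ v ∈ U, ∃ z ∈ U.erase v, s(v, z) ∉ B ∧
      (liveEdges B ((U.erase v).erase z) ∅).card ≤ (liveEdges B U ∅).card - 2 := by
  have hlive : ∀ {s}, s ∈ liveEdges B U ∅ → ∃ x ∈ U, ∃ y ∈ U, s(x, y) ∈ B ∧ s = s(x, y) := by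
    intro s hs
    obtain ⟨hsB, ⟨x, hx, hxs⟩, hall⟩ := mem_liveEdges.1 hs
    obtain ⟨y, rfl⟩ := Sym2.mem_iff_exists.1 hxs
    exact ⟨x, hx, y, by simpa using hall y (by simp), hsB, rfl⟩
  by_cases h1 : ∃ v ∈ U, 2 ≤ (nbrs B U {v}).card
  · obtain ⟨v, hv, hv2⟩ := h1
    have hE := card_liveEdges_erase hB hv
    -- The degree of `v` is at most the number of live edges, hence below `|U| - 1`.
    have : ∃ z ∈ U.erase v, z ∉ nbrs B U {v} :=
      Finset.exists_mem_notMem_of_card_lt_card (by rw [Finset.card_erase_of_mem hv]; omega)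
    obtain ⟨z, hz, hzN⟩ := this
    obtain ⟨hzv, hzU⟩ := Finset.mem_erase.1 hz
    have hvz : s(v, z) ∉ B := fun h => hzN (mem_nbrs_singleton.2 ⟨hzU, h⟩)
    have := card_liveEdges_erase_erase hB hv hzU hzv hvz
    exact ⟨v, hv, z, hz, hvz, by omega⟩
  push Not at h1
  by_cases h2 : ∃ v ∈ U, ∃ z ∈ U.erase v, s(v, z) ∉ B ∧ (nbrs B U {v}).Nonempty ∧
      (nbrs B U {z}).Nonempty
  · obtain ⟨v, hv, z, hz, hvz, hv1, hz1⟩ := h2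
    obtain ⟨hzv, hzU⟩ := Finset.mem_erase.1 hz
    have := card_liveEdges_erase_erase hB hv hzU hzv hvz
    have := hv1.card_pos
    have := hz1.card_pos
    exact ⟨v, hv, z, hz, hvz, by omega⟩
  push Not at h2
  have huniq : ∀ {x y z}, x ∈ U → y ∈ U → z ∈ U → s(x, y) ∈ B → s(x, z) ∈ B → y = z := by
    intro x y z hx hy hz hxy hxz
    have := h1 x hx
    exact Finset.card_le_one.1 (by omega) _ (mem_nbrs_singleton.2 ⟨hy, hxy⟩) _
      (mem_nbrs_singleton.2 ⟨hz, hxz⟩)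
  -- All degrees are at most one and non-isolated vertices are pairwise adjacent.
  have hone : (liveEdges B U ∅).card ≤ 1 := by
    rw [Finset.card_le_one]
    intro s hs t ht
    obtain ⟨x, hx, y, hy, hxy, rfl⟩ := hlive hs
    obtain ⟨x', hx', y', hy', hxy', rfl⟩ := hlive ht
    by_cases hxx : x' = x
    · subst hxx
      rw [huniq hx hy hy' hxy hxy']
    · by_cases hadj : s(x, x') ∈ B
      · obtain rfl := huniq hx hy hx' hxy hadj
        rw [huniq hy hx hy' (by rwa [Sym2.eq_swap]) hxy', Sym2.eq_swap]
      · have := h2 x hx x' (Finset.mem_erase.2 ⟨hxx, hx'⟩) hadj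
          ⟨y, mem_nbrs_singleton.2 ⟨hy, hxy⟩⟩
        have h' := mem_nbrs_singleton.2 ⟨hy', hxy'⟩
        simp [this] at h'
  rcases Finset.eq_empty_or_nonempty (liveEdges B U ∅) with h0 | ⟨s, hs⟩
  · obtain ⟨v, hv, z, hz, hvz⟩ := Finset.one_lt_card.1 (show 1 < U.card by omega)
    refine ⟨v, hv, z, Finset.mem_erase.2 ⟨hvz.symm, hz⟩, fun hB' => ?_, ?_⟩
    · have : s(v, z) ∈ liveEdges B U ∅ :=
        mem_liveEdges.2 ⟨hB', ⟨v, hv, by simp⟩, by simp [hv, hz]⟩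
      simp [h0] at this
    · have h3 := card_liveEdges_erase hB hv
      have h4 := card_liveEdges_erase hB (Finset.mem_erase.2 ⟨hvz.symm, hz⟩)
      simp only [h0, Finset.card_empty] at *
      omega
  · have hpos := Finset.card_pos.2 ⟨s, hs⟩
    obtain ⟨x, hx, y, hy, hxy, rfl⟩ := hlive hs
    obtain ⟨z, hz, hzxy⟩ := Finset.exists_mem_notMem_of_card_lt_card
      (s := ({x, y} : Finset V)) (t := U) ((Finset.card_le_two).trans_lt (by omega))
    simp only [Finset.mem_insert, Finset.mem_singleton, not_or] at hzxy
    have hxz : s(x, z) ∉ B := fun h => hzxy.2 (huniq hx hy hz hxy h).symm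
    refine ⟨x, hx, z, Finset.mem_erase.2 ⟨hzxy.1, hz⟩, hxz, ?_⟩
    have := card_liveEdges_erase_erase hB hx hz hzxy.1 hxz
    have := Finset.card_pos.2 ⟨y, mem_nbrs_singleton.2 ⟨hy, hxy⟩⟩
    omega

/-- The number of pairs in `W × R` that `B` contains. -/
noncomputable def crossing (B : Finset (Sym2 V)) (W R : Finset V) : ℕ :=
  ∑ w ∈ W, (nbrs B R {w}).card

lemma crossing_le_card (hWR : Disjoint W R) {D : Finset (Sym2 V)}
    (hD : ∀ w ∈ W, ∀ x ∈ R, s(w, x) ∈ B → s(w, x) ∈ D) : crossing B W R ≤ D.card := by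
  rw [crossing, ← Finset.card_sigma]
  refine Finset.card_le_card_of_injOn (fun p => s(p.1, p.2)) ?_ ?_
  · rintro ⟨w, x⟩ h
    simp only [Finset.coe_sigma, Set.mem_sigma_iff, Finset.mem_coe, mem_nbrs_singleton] at h
    exact hD w h.1 x h.2.1 h.2.2
  · rintro ⟨w, x⟩ h ⟨w', x'⟩ h' heq
    simp only [Finset.coe_sigma, Set.mem_sigma_iff, Finset.mem_coe, mem_nbrs_singleton] at h h'
    rcases Sym2.eq_iff.1 heq with ⟨h1, h2⟩ | ⟨h1, -⟩
    · simp only at h1 h2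
      subst h1 h2
      rfl
    · simp only at h1
      exact absurd h'.2.1 (h1 ▸ Finset.disjoint_left.1 hWR h.1)

lemma crossing_le_card_liveEdges (hWR : Disjoint W R) :
    crossing B W R ≤ (liveEdges B W R).card :=
  crossing_le_card hWR fun w hw x hx h => mem_liveEdges.2 ⟨h, ⟨w, hw, by simp⟩, by simp [hw, hx]⟩

lemma crossing_union_le (hWR : Disjoint W R) :
    crossing (B ∪ T) W R ≤ crossing B W R + T.card := by
  refine le_trans ?_ (add_le_add le_rfl (crossing_le_card (B := T) hWR fun _ _ _ _ h => h))
  rw [crossing, crossing, crossing, ← Finset.sum_add_distrib]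
  refine Finset.sum_le_sum fun w _ => (Finset.card_le_card ?_).trans (Finset.card_union_le _ _)
  intro y hy
  simp only [Finset.mem_union, mem_nbrs_singleton] at hy ⊢
  tauto

end LiveEdges

/-! ### Bookkeeping of Maker's paths. -/

section Config

variable {V : Type*} [DecidableEq V]

/-- The first and the last vertex of a list. -/
def ends (l : List V) : Finset V := l.head?.toFinset ∪ l.getLast?.toFinset

lemma mem_of_mem_ends {l : List V} {x : V} (h : x ∈ ends l) : x ∈ l := by
  simp only [ends, Finset.mem_union, Option.mem_toFinset] at h
  exact h.elim List.mem_of_mem_head? List.mem_of_mem_getLast?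

lemma card_ends {l : List V} (hl : l.Nodup) (h2 : 2 ≤ l.length) : (ends l).card = 2 := by
  obtain ⟨x, l, rfl⟩ := List.exists_cons_of_length_pos (show 0 < l.length by omega)
  rw [List.length_cons] at h2
  have hne : l ≠ [] := List.ne_nil_of_length_pos (by omega)
  have h1 : ends (x :: l) = {x, l.getLast hne} := by
    ext y
    simp [ends, List.getLast?_cons, List.getLast?_eq_some_getLast hne, eq_comm]
  rw [h1, Finset.card_pair]
  rintro h
  exact (List.nodup_cons.1 hl).1 (h ▸ List.getLast_mem hne)

/-- The end vertices of the paths in `I`. -/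
def allEnds (I : Finset (List V)) : Finset V := I.biUnion ends

variable [Fintype V]

/-- The vertex set is partitioned into the paths in `F` with `k` vertices, the paths in `I` with
`k - 1` vertices, the path `p` and the isolated vertices `U`; all these paths lie in `M`. -/
structure Config (k : ℕ) (M : Finset (Sym2 V)) (F : Multiset (List V)) (I : Finset (List V))
    (p : List V) (U : Finset V) : Prop where
  full : ∀ l ∈ F, l.length = k ∧ IsTrailIn M l
  reserved : ∀ l ∈ I, l.length + 1 = k ∧ IsTrailIn M l
  trail : IsTrailIn M p
  cover : F.bind Multiset.ofList + I.val.bind Multiset.ofList + (p : Multiset V) + U.val =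
    Finset.univ.val

namespace Config

variable {k : ℕ} {M M' : Finset (Sym2 V)} {F : Multiset (List V)} {I : Finset (List V)}
  {p : List V} {U : Finset V}

lemma mono (h : Config k M F I p U) (hM : M ⊆ M') : Config k M' F I p U :=
  ⟨fun l hl => ⟨(h.full l hl).1, (h.full l hl).2.mono hM⟩,
    fun l hl => ⟨(h.reserved l hl).1, (h.reserved l hl).2.mono hM⟩, h.trail.mono hM, h.cover⟩

/-- Disjointness of the pieces is read off from this. -/
lemma nodup_cover (h : Config k M F I p U) :
    (F.bind Multiset.ofList + I.val.bind Multiset.ofList + (p : Multiset V) + U.val).Nodup :=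
  h.cover ▸ Finset.univ.nodup

lemma not_mem_of_mem_trail (h : Config k M F I p U) {x : V} (hx : x ∈ p) : x ∉ U := by
  have h1 := (Multiset.nodup_add.1 h.nodup_cover).2.2
  exact Multiset.disjoint_left.1 h1 (Multiset.mem_add.2 (Or.inr (Multiset.mem_coe.2 hx)))

lemma not_mem_of_mem_reserved (h : Config k M F I p U) {x : V} {l : List V} (hl : l ∈ I)
    (hx : x ∈ l) : x ∉ U ∧ x ∉ p := by
  have h1 := Multiset.nodup_add.1 h.nodup_cover
  have h2 := Multiset.nodup_add.1 h1.1
  have h3 : x ∈ F.bind Multiset.ofList + I.val.bind Multiset.ofList :=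
    Multiset.mem_add.2 (Or.inr (Multiset.mem_bind.2 ⟨l, hl, Multiset.mem_coe.2 hx⟩))
  exact ⟨Multiset.disjoint_left.1 h1.2.2 (Multiset.mem_add.2 (Or.inl h3)),
    fun hp => Multiset.disjoint_left.1 h2.2.2 h3 (Multiset.mem_coe.2 hp)⟩

lemma disjoint_allEnds (h : Config k M F I p U) : Disjoint U (allEnds I) := by
  rw [Finset.disjoint_left]
  intro x hxU hx
  obtain ⟨l, hl, hxl⟩ := Finset.mem_biUnion.1 hx
  exact (h.not_mem_of_mem_reserved hl (mem_of_mem_ends hxl)).1 hxU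

lemma not_mem_allEnds (h : Config k M F I p U) {x : V} (hx : x ∈ p) : x ∉ allEnds I := by
  intro hxI
  obtain ⟨l, hl, hxl⟩ := Finset.mem_biUnion.1 hxI
  exact (h.not_mem_of_mem_reserved hl (mem_of_mem_ends hxl)).2 hx

lemma nodup_reserved (h : Config k M F I p U) {l : List V} (hl : l ∈ I) : l.Nodup := by
  have h1 := (Multiset.nodup_add.1 (Multiset.nodup_add.1 (Multiset.nodup_add.1
    h.nodup_cover).1).1).2.1
  exact Multiset.coe_nodup.1 ((Multiset.nodup_bind.1 h1).1 l hl)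

lemma disjoint_ends (h : Config k M F I p U) {l l' : List V} (hl : l ∈ I) (hl' : l' ∈ I)
    (hne : l ≠ l') : Disjoint (ends l) (ends l') := by
  have h1 := (Multiset.nodup_add.1 (Multiset.nodup_add.1 (Multiset.nodup_add.1
    h.nodup_cover).1).1).2.1
  rw [← Multiset.cons_erase (show l ∈ I.val from hl), Multiset.cons_bind, Multiset.nodup_add] at h1
  rw [Finset.disjoint_left]
  intro x hx hx'
  refine Multiset.disjoint_left.1 h1.2.2 (Multiset.mem_coe.2 (mem_of_mem_ends hx))
    (Multiset.mem_bind.2 ⟨l', ?_, Multiset.mem_coe.2 (mem_of_mem_ends hx')⟩)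
  exact (Multiset.mem_erase_of_ne hne.symm).2 hl'

/-- Distinct reserved paths have disjoint ends, so the crossing number is the total of a matrix
indexed by vertices and paths, as in `exists_entry_le_one`. -/
lemma crossing_eq (h : Config k M F I p U) (B : Finset (Sym2 V)) {I' : Finset (List V)}
    (hI' : I' ⊆ I) (W : Finset V) :
    crossing B W (allEnds I') = ∑ w ∈ W, ∑ l ∈ I', (nbrs B (ends l) {w}).card := by
  refine Finset.sum_congr rfl fun w _ => ?_
  rw [← Finset.card_biUnion]
  · congr 1
    ext x
    simp only [mem_nbrs_singleton, allEnds, Finset.mem_biUnion]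
    tauto
  · intro l hl l' hl' hne
    refine (h.disjoint_ends (hI' hl) (hI' hl') hne).mono ?_ ?_ <;> exact Finset.filter_subset _ _

lemma pick (h : Config k M F I [] U) {w : V} (hw : w ∈ U) : Config k M F I [w] (U.erase w) := by
  refine ⟨h.full, h.reserved, List.isChain_singleton w, ?_⟩
  rw [← h.cover, Finset.erase_val, ← Multiset.cons_erase (show w ∈ U.val from hw),
    Multiset.erase_cons_head]
  simp only [← Multiset.singleton_add, Multiset.coe_singleton, Multiset.coe_nil]
  abel

lemma extend {x : V} (h : Config k M F I (x :: p) U) {w : V} (hw : w ∈ U) :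
    Config k (insert s(x, w) M) F I (w :: x :: p) (U.erase w) := by
  have h' := h.mono (Finset.subset_insert s(x, w) M)
  refine ⟨h'.full, h'.reserved, ?_, ?_⟩
  · exact List.isChain_cons_cons.2 ⟨by rw [Sym2.eq_swap]; exact Finset.mem_insert_self _ _, h'.trail⟩
  · rw [← h.cover, Finset.erase_val, ← Multiset.cons_erase (show w ∈ U.val from hw),
      Multiset.erase_cons_head, ← Multiset.cons_coe w]
    simp only [← Multiset.singleton_add]
    abel

lemma close (h : Config k M F I p U) (hp : p.length = k) : Config k M (p ::ₘ F) I [] U := by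
  refine ⟨?_, h.reserved, List.isChain_nil, ?_⟩
  · intro l hl
    rcases Multiset.mem_cons.1 hl with rfl | hl
    · exact ⟨hp, h.trail⟩
    · exact h.full l hl
  · rw [← h.cover, Multiset.cons_bind, Multiset.coe_nil]
    abel

lemma not_mem_reserved (h : Config k M F I p U) (hp : p ≠ []) : p ∉ I := fun hpI =>
  (h.not_mem_of_mem_reserved hpI (List.head_mem hp)).2 (List.head_mem hp)

lemma reserve (h : Config k M F I p U) (hp : p.length + 1 = k) (hne : p ≠ []) :
    Config k M F (insert p I) [] U := by
  refine ⟨h.full, ?_, List.isChain_nil, ?_⟩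
  · intro l hl
    rcases Finset.mem_insert.1 hl with rfl | hl
    · exact ⟨hp, h.trail⟩
    · exact h.reserved l hl
  · rw [← h.cover, Finset.insert_val_of_notMem (h.not_mem_reserved hne), Multiset.cons_bind,
      Multiset.coe_nil]
    abel

lemma complete (h : Config k M F I [] U) {l : List V} (hl : l ∈ I) {w x : V} (hw : w ∈ U)
    (hx : x ∈ ends l) :
    ∃ l', Config k (insert s(w, x) M) (l' ::ₘ F) (I.erase l) [] (U.erase w) := by
  have h' := h.mono (Finset.subset_insert s(w, x) M)
  -- Orient the path so that `x` is its head.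
  obtain ⟨r, hr, hrM, hrx⟩ : ∃ r : List V, (r : Multiset V) = l ∧
      IsTrailIn (insert s(w, x) M) r ∧ x ∈ r.head? := by
    simp only [ends, Finset.mem_union, Option.mem_toFinset] at hx
    rcases hx with hx | hx
    · exact ⟨l, rfl, (h'.reserved l hl).2, hx⟩
    · exact ⟨l.reverse, Multiset.coe_reverse l, (h'.reserved l hl).2.reverse,
        by rwa [List.head?_reverse]⟩
  have hlen : r.length = l.length := by rw [← Multiset.coe_card, hr, Multiset.coe_card]
  refine ⟨w :: r, ?_, fun m hm => h'.reserved m (Finset.mem_of_mem_erase hm), h'.trail, ?_⟩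
  · intro m hm
    rcases Multiset.mem_cons.1 hm with rfl | hm
    · refine ⟨by rw [List.length_cons, hlen]; exact (h.reserved l hl).1, ?_⟩
      refine List.isChain_cons.2 ⟨fun y hy => ?_, hrM⟩
      rw [Option.mem_unique hy hrx]
      exact Finset.mem_insert_self _ _
    · exact h'.full m hm
  · rw [← h.cover, Multiset.cons_bind, Finset.erase_val, Finset.erase_val,
      ← Multiset.cons_erase (show w ∈ U.val from hw), Multiset.erase_cons_head,
      ← Multiset.cons_erase (show l ∈ I.val from hl), Multiset.erase_cons_head,
      Multiset.cons_bind, ← Multiset.cons_coe w, hr]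
    simp only [← Multiset.singleton_add]
    abel

end Config

end Config

/-! ### The phases of Maker's plan and their invariants. -/

section Strategy

variable {V : Type*} [DecidableEq V] [Fintype V]

/-- Building `a + 3` reserved paths: `q` of them are still to be started, and the current one,
`x :: p`, needs `r` more vertices. -/
def BuildingReserved (a κ s m : ℕ) (M B : Finset (Sym2 V)) : Prop :=
  ∃ F I x p U q r J, Config (κ + 3) M F I (x :: p) U ∧ I.card + 1 + q = a + 3 ∧
    p.length + r = κ + 1 ∧ 1 ≤ r ∧ U.card = a + 3 + (κ + 3) * J + q * (κ + 2) + r ∧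
    m = a + 3 + (κ + 2) * J + q * (κ + 1) + r ∧ B.card + q * (κ + 1) + r ≤ J + s + 1

/-- Building complete paths one at a time: `J` of them are still to be started, and the current
one, `x :: p`, needs `r` more vertices. -/
def BuildingComplete (a κ s m : ℕ) (M B : Finset (Sym2 V)) : Prop :=
  ∃ F I x p U r J, Config (κ + 3) M F I (x :: p) U ∧ I.card = a + 3 ∧
    p.length + r = κ + 2 ∧ 1 ≤ r ∧ U.card = a + 3 + (κ + 3) * J + r ∧
    m = a + 3 + (κ + 2) * J + r ∧ danger B U (allEnds I) {x} ≤ 2 + J + s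

/-- Completing the reserved paths. -/
def CompletingReserved (κ s m : ℕ) (M B : Finset (Sym2 V)) : Prop :=
  ∃ F I U, Config (κ + 3) M F I [] U ∧ I.card = m ∧ U.card = m ∧
    (crossing B U (allEnds I) + 1 ≤ m + s ∨ m = 0)

variable {a κ s m : ℕ} {M B T : Finset (Sym2 V)}

lemma BuildingReserved.reply (h : BuildingReserved a κ 0 m M B) (hT : T.card ≤ a) :
    BuildingReserved a κ a m M (B ∪ T) := by
  obtain ⟨F, I, x, p, U, q, r, J, h1, h2, h3, h4, h5, h6, h7⟩ := h
  have := Finset.card_union_le B T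
  exact ⟨F, I, x, p, U, q, r, J, h1, h2, h3, h4, h5, h6, by omega⟩

lemma BuildingComplete.reply (h : BuildingComplete a κ 0 m M B) (hT : T.card ≤ a) :
    BuildingComplete a κ a m M (B ∪ T) := by
  obtain ⟨F, I, x, p, U, r, J, h1, h2, h3, h4, h5, h6, h7⟩ := h
  have := danger_union_le (B := B) (T := T) (U := U) (R := allEnds I) (O := {x})
  exact ⟨F, I, x, p, U, r, J, h1, h2, h3, h4, h5, h6, by omega⟩

lemma CompletingReserved.reply (h : CompletingReserved κ 0 m M B) (hT : T.card ≤ a) :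
    CompletingReserved κ a m M (B ∪ T) := by
  obtain ⟨F, I, U, h1, h2, h3, h4⟩ := h
  have := crossing_union_le (B := B) (T := T) h1.disjoint_allEnds
  exact ⟨F, I, U, h1, h2, h3, by omega⟩

/-- Choosing a first vertex costs no edge but lowers the danger, which pays for `J` dropping by one.
At `J = 0` the danger is at most `2 + s`, low enough to begin completing the reserved paths. -/
lemma Config.start_path {F : Multiset (List V)} {I : Finset (List V)} {U : Finset V} {J : ℕ}
    (h : Config (κ + 3) M F I [] U) (hB : ∀ v, s(v, v) ∉ B) (hI : I.card = a + 3)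
    (hU : U.card = a + 3 + (κ + 3) * J) (hd : danger B U (allEnds I) ∅ ≤ 2 + J + s)
    (hm : m = a + 3 + (κ + 2) * J) :
    BuildingComplete a κ s m M B ∨ CompletingReserved κ s m M B := by
  rcases J with _ | J
  · right
    have h1 := crossing_le_card_liveEdges (B := B) h.disjoint_allEnds
    have h2 : (liveEdges B U (allEnds I)).card ≤ danger B U (allEnds I) ∅ := by
      rw [danger, Finset.union_empty]
      omega
    exact ⟨F, I, U, h, by omega, by omega, by omega⟩
  · left
    obtain ⟨w, hw, -, hlt⟩ := exists_danger_lt (O := ∅) hB (by simp) (by simp)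
      h.disjoint_allEnds (by rw [nbrs_empty, Finset.card_empty]; omega)
    rw [mul_add, mul_one] at hU hm
    refine ⟨F, I, w, [], U.erase w, κ + 2, J, h.pick hw, hI, by simp, by omega, ?_, by omega,
      by omega⟩
    rw [Finset.card_erase_of_mem hw]
    omega

lemma ne_of_mem_of_mem_trail {k : ℕ} {F : Multiset (List V)} {I : Finset (List V)} {x w : V}
    {p : List V} {U : Finset V} (h : Config k M F I (x :: p) U) (hw : w ∈ U) : x ≠ w := by
  rintro rfl
  exact h.not_mem_of_mem_trail List.mem_cons_self hw

/-- Here Breaker's edges are merely counted: they are fewer than the vertices of `U`, so the current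
end can be extended. At the end of the phase this count plus one for the bonus bounds the danger. -/
lemma BuildingReserved.claim (h : BuildingReserved a κ (s + 1) (m + 1) M B) (hs : s + 1 ≤ a)
    (hB : ∀ v, s(v, v) ∉ B) :
    ∃ x w, x ≠ w ∧ s(x, w) ∉ B ∧ (BuildingReserved a κ s m (insert s(x, w) M) B ∨
      BuildingComplete a κ s m (insert s(x, w) M) B ∨
      CompletingReserved κ s m (insert s(x, w) M) B) := by
  obtain ⟨F, I, x, p, U, q, r, J, h1, h2, h3, h4, h5, h6, h7⟩ := h
  have hJ : J ≤ (κ + 3) * J := Nat.le_mul_of_pos_left J (by omega)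
  obtain ⟨D, hDB, hD, -⟩ := exists_crossing_edges (B := B) (U := U) (X := {x})
    (Finset.disjoint_singleton_right.2 (h1.not_mem_of_mem_trail List.mem_cons_self))
  have hDB := Finset.card_le_card hDB
  obtain ⟨w, hw, hwN⟩ := Finset.exists_mem_notMem_of_card_lt_card
    (show (nbrs B U {x}).card < U.card by omega)
  refine ⟨x, w, ne_of_mem_of_mem_trail h1 hw, fun h => hwN (mem_nbrs_singleton.2 ⟨hw, h⟩), ?_⟩
  have hc := h1.extend hw
  have hUw := Finset.card_erase_of_mem hw
  obtain ⟨r, rfl⟩ : ∃ r', r = r' + 1 := ⟨r - 1, by omega⟩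
  rcases Nat.eq_zero_or_pos r with rfl | hr
  · have hc' := hc.reserve (by simp only [List.length_cons]; omega) (by simp)
    have hI : (insert (w :: x :: p) I).card = I.card + 1 :=
      Finset.card_insert_of_notMem (hc.not_mem_reserved (by simp))
    rcases q with _ | q
    · right
      refine hc'.start_path hB (by omega) (J := J) (by omega) ?_ (by omega)
      have : (liveEdges B (U.erase w) (allEnds (insert (w :: x :: p) I) ∪ ∅)).card ≤ B.card :=
        Finset.card_le_card fun s hs => (mem_liveEdges.1 hs).1
      unfold danger
      split_ifs <;> omega
    · left
      rw [add_mul q, one_mul] at h5 h6 h7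
      obtain ⟨y, hy⟩ := Finset.card_pos.1 (show 0 < (U.erase w).card by omega)
      refine ⟨F, _, y, [], _, q, κ + 1, J, hc'.pick hy, by omega, by simp, by omega, ?_, by omega,
        by omega⟩
      rw [Finset.card_erase_of_mem hy]
      omega
  · left
    exact ⟨F, I, w, x :: p, U.erase w, q, r, J, hc, h2, by rw [List.length_cons]; omega, hr,
      by omega, by omega, by omega⟩

/-- The danger is at most `2 + J + a`. The `a + 3` vertices kept for the reserved paths make `U`
larger than that, so an extension exists. -/
lemma BuildingComplete.claim (h : BuildingComplete a κ (s + 1) (m + 1) M B) (hs : s + 1 ≤ a)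
    (hB : ∀ v, s(v, v) ∉ B) :
    ∃ x w, x ≠ w ∧ s(x, w) ∉ B ∧ (BuildingComplete a κ s m (insert s(x, w) M) B ∨
      CompletingReserved κ s m (insert s(x, w) M) B) := by
  obtain ⟨F, I, x, p, U, r, J, h1, h2, h3, h4, h5, h6, h7⟩ := h
  have hJ : J ≤ (κ + 3) * J := Nat.le_mul_of_pos_left J (by omega)
  have hxU : Disjoint U {x} :=
    Finset.disjoint_singleton_right.2 (h1.not_mem_of_mem_trail List.mem_cons_self)
  have hxR : Disjoint (allEnds I) {x} :=
    Finset.disjoint_singleton_right.2 (h1.not_mem_allEnds List.mem_cons_self)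
  have hN : (nbrs B U {x}).card < U.card := by
    have h8 := card_liveEdges_drop (B := B) hxU hxR
    have h9 : (liveEdges B U (allEnds I ∪ {x})).card ≤ danger B U (allEnds I) {x} :=
      Nat.le_add_right _ _
    omega
  obtain ⟨w, hw, hwN, hlt⟩ := exists_danger_lt hB hxU hxR h1.disjoint_allEnds hN
  refine ⟨x, w, ne_of_mem_of_mem_trail h1 hw, fun h => hwN (mem_nbrs_singleton.2 ⟨hw, h⟩), ?_⟩
  have hc := h1.extend hw
  have hUw := Finset.card_erase_of_mem hw
  obtain ⟨r, rfl⟩ : ∃ r', r = r' + 1 := ⟨r - 1, by omega⟩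
  rcases Nat.eq_zero_or_pos r with rfl | hr
  · refine (hc.close (by simp only [List.length_cons]; omega)).start_path hB h2 (J := J)
      (by omega) ?_ (by omega)
    refine (danger_drop_le (O := {w}) ?_ ?_).trans (by omega)
    · simp
    · exact Finset.disjoint_singleton_right.2 (hc.not_mem_allEnds List.mem_cons_self)
  · left
    exact ⟨F, I, w, x :: p, U.erase w, r, J, hc, h2, by rw [List.length_cons]; omega, hr,
      by omega, by omega, by omega⟩

/-- A claim lowers `m + s` by two and discards two crossing edges or all. From `s ≤ m` the crossing
number is below `2 * (m + 1)`, and an entry at most one leaves one of the two ends available. -/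
lemma CompletingReserved.claim (h : CompletingReserved κ (s + 1) (m + 1) M B) (hs : s ≤ m) :
    ∃ x w, x ≠ w ∧ s(x, w) ∉ B ∧ CompletingReserved κ s m (insert s(x, w) M) B := by
  obtain ⟨F, I, U, h1, h2, h3, h4⟩ := h
  have heq := h1.crossing_eq B (Finset.Subset.refl I) U
  obtain ⟨l, hl, w, hw, hle, hsum⟩ := exists_entry_le_one h2 h3 (by omega)
    (fun l w => (nbrs B (ends l) {w}).card) (by rw [← heq]; omega)
  have hends := card_ends (h1.nodup_reserved hl) (by have := (h1.reserved l hl).1; omega)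
  obtain ⟨x, hx, hxN⟩ := Finset.exists_mem_notMem_of_card_lt_card
    (show (nbrs B (ends l) {w}).card < (ends l).card by omega)
  obtain ⟨l', hc⟩ := h1.complete hl hw hx
  refine ⟨w, x, ?_, fun h => hxN (mem_nbrs_singleton.2 ⟨hx, h⟩), _, _, _, hc, ?_, ?_, ?_⟩
  · rintro rfl
    exact (h1.not_mem_of_mem_reserved hl (mem_of_mem_ends hx)).1 hw
  · rw [Finset.card_erase_of_mem hl]
    omega
  · rw [Finset.card_erase_of_mem hw]
    omega
  · rw [h1.crossing_eq B (Finset.erase_subset l I)]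
    omega

/-- Building single edges when `k = 2`. -/
def BuildingMatching (s m : ℕ) (M B : Finset (Sym2 V)) : Prop :=
  ∃ F U, Config 2 M F ∅ [] U ∧ U.card = 2 * m ∧ ((liveEdges B U ∅).card + 2 ≤ m + s ∨ m = 0)

lemma BuildingMatching.reply (h : BuildingMatching 0 m M B) (hT : T.card ≤ a) :
    BuildingMatching a m M (B ∪ T) := by
  obtain ⟨F, U, h1, h2, h3⟩ := h
  have := card_liveEdges_union_le (B := B) (T := T) (U := U) ∅
  exact ⟨F, U, h1, h2, by omega⟩

/-- If the claim kills all live edges, the new bound still asks for `s + m ≥ 2` or `m = 0`; the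
hypothesis `s + m ≠ 1` excludes the failing case. -/
lemma BuildingMatching.claim (h : BuildingMatching (s + 1) (m + 1) M B) (hs : s ≤ m)
    (hsm : s + m ≠ 1) (hB : ∀ v, s(v, v) ∉ B) :
    ∃ x w, x ≠ w ∧ s(x, w) ∉ B ∧ BuildingMatching s m (insert s(x, w) M) B := by
  obtain ⟨F, U, h1, h2, h3⟩ := h
  obtain ⟨v, hv, z, hz, hvz, hlt⟩ := exists_pair_not_mem (B := B) (U := U) hB (by omega)
  refine ⟨v, z, (Finset.ne_of_mem_erase hz).symm, hvz, _, _,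
    ((h1.pick hv).extend hz).close rfl, ?_, by omega⟩
  rw [Finset.card_erase_of_mem hz, Finset.card_erase_of_mem hv]
  omega

lemma Config.nil (k : ℕ) (M : Finset (Sym2 V)) : Config k M 0 ∅ [] Finset.univ :=
  ⟨by simp, by simp, List.isChain_nil, by simp⟩

lemma Config.exists_isPathFactor {k : ℕ} {F : Multiset (List V)} {I : Finset (List V)}
    {U : Finset V} (h : Config k M F I [] U) (hI : I.card = 0) (hU : U.card = 0) :
    ∃ H : SimpleGraph V, IsPathFactor k H ∧ H.edgeSet ⊆ M := by
  refine exists_isPathFactor_of_trails h.full ?_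
  rw [Finset.card_eq_zero] at hI hU
  rw [← h.cover, hI, hU]
  simp

end Strategy

/-! ### Winning the path factor game. -/

open PositionalGame

variable {n k a : ℕ}

lemma mk_mem_board {x w : Fin n} : s(x, w) ∈ (pathFactorGame n k).board ↔ x ≠ w := by
  simp [pathFactorGame]

lemma loopless_of_subset_board {B : Finset (Sym2 (Fin n))}
    (hB : B ⊆ (pathFactorGame n k).board) (v : Fin n) : s(v, v) ∉ B := fun h =>
  mk_mem_board.1 (hB h) rfl

lemma occupies_of_isPathFactor {M : Finset (Sym2 (Fin n))} {H : SimpleGraph (Fin n)}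
    (hH : IsPathFactor k H) (hM : H.edgeSet ⊆ M) : (pathFactorGame n k).Occupies M := by
  classical
  exact ⟨H.edgeFinset, ⟨H, hH, SimpleGraph.coe_edgeFinset H⟩, by
    rwa [← Finset.coe_subset, SimpleGraph.coe_edgeFinset]⟩

lemma winsMidMove_of_three_le {κ J s t : ℕ} {B : Finset (Sym2 (Fin n))}
    (hn : n = (κ + 3) * (a + 3 + J)) (hJ : a + (a + 3) * (κ + 1) ≤ J)
    (hB : B ⊆ (pathFactorGame n (κ + 3)).board) (hBa : B.card ≤ a) (hs : s ≤ a)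
    (hst : (κ + 2) * (a + 3 + J) = s + a * t) :
    (pathFactorGame n (κ + 3)).WinsMidMove a s t ∅ B := by
  refine WinsMidMove.of_invariant (m := (κ + 2) * (a + 3 + J))
    (fun s m M B => BuildingReserved a κ s m M B ∨ BuildingComplete a κ s m M B ∨
      CompletingReserved κ s m M B) ?_ ?_ ?_ hB hs hst ?_
  · rintro s m M B hs ⟨t, ht⟩ hB h
    have hB' := loopless_of_subset_board hB
    rcases h with h | h | h
    · obtain ⟨x, w, hxw, hB, h⟩ := h.claim hs hB'
      exact ⟨_, mk_mem_board.2 hxw, hB, h⟩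
    · obtain ⟨x, w, hxw, hB, h⟩ := h.claim hs hB'
      exact ⟨_, mk_mem_board.2 hxw, hB, Or.inr h⟩
    · obtain ⟨x, w, hxw, hB, h⟩ := h.claim (by omega)
      exact ⟨_, mk_mem_board.2 hxw, hB, Or.inr (Or.inr h)⟩
  · rintro m M B T - - - hT (h | h | h)
    · exact Or.inl (h.reply hT)
    · exact Or.inr (Or.inl (h.reply hT))
    · exact Or.inr (Or.inr (h.reply hT))
  · rintro s M B (⟨F, I, x, p, U, q, r, J, h⟩ | ⟨F, I, x, p, U, r, J, h⟩ | ⟨F, I, U, h⟩)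
    · omega
    · omega
    · obtain ⟨H, hH, hM⟩ := h.1.exists_isPathFactor h.2.1 h.2.2.1
      exact occupies_of_isPathFactor hH hM
  · left
    have hn0 : 0 < n := by rw [hn]; positivity
    -- The reserved phase takes `(a + 3) * (κ + 1)` claims; `hJ` leaves room for these and for the
    -- at most `a` edges in `B`.
    refine ⟨0, ∅, ⟨0, hn0⟩, [], _, a + 2, κ + 1, J, (Config.nil _ _).pick (Finset.mem_univ _),
      by simp; omega, by simp, by omega, ?_, by ring, ?_⟩
    · rw [Finset.card_erase_of_mem (Finset.mem_univ _), Finset.card_univ, Fintype.card_fin, hn,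
        Nat.sub_eq_iff_eq_add (by rw [← hn]; omega)]
      ring
    · rw [add_mul] at hJ ⊢
      omega

lemma winsMidMove_two {N s t : ℕ} {B : Finset (Sym2 (Fin n))} (ha : 2 ≤ a)
    (hn : n = 2 * N) (hN : a + 2 ≤ N) (hB : B ⊆ (pathFactorGame n 2).board)
    (hBa : B.card ≤ a) (hs : s ≤ a) (hst : N = s + a * t) :
    (pathFactorGame n 2).WinsMidMove a s t ∅ B := by
  refine WinsMidMove.of_invariant (m := N) (fun s m M B => BuildingMatching s m M B)
    ?_ ?_ ?_ hB hs hst ?_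
  · rintro s m M B hs ⟨t, ht⟩ hB h
    -- Since `s + m = 2 * s + a * t`, the value 1 would force `a = 1`.
    have hsm : s + m ≠ 1 := by
      intro h1
      rcases t with _ | t
      · omega
      · rw [mul_add] at ht
        omega
    obtain ⟨x, w, hxw, hB, h⟩ := h.claim (by omega) hsm (loopless_of_subset_board hB)
    exact ⟨_, mk_mem_board.2 hxw, hB, h⟩
  · rintro m M B T - - - hT h
    exact h.reply hT
  · rintro s M B ⟨F, U, h⟩
    obtain ⟨H, hH, hM⟩ := h.1.exists_isPathFactor rfl (by omega)
    exact occupies_of_isPathFactor hH hM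
  · have : (liveEdges B Finset.univ ∅).card ≤ B.card :=
      Finset.card_le_card fun s hs => (mem_liveEdges.1 hs).1
    exact ⟨0, _, Config.nil _ _, by simp [hn], by omega⟩

lemma winsMidMove_pathFactorGame {N s t : ℕ} {B : Finset (Sym2 (Fin n))} (hk : 2 ≤ k)
    (hak : ¬ (a = 1 ∧ k = 2)) (ha : 1 ≤ a) (hn : n = k * N)
    (hN : a + 3 + (a + (a + 3) * k) ≤ N) (hB : B ⊆ (pathFactorGame n k).board)
    (hBa : B.card ≤ a) (hs : s ≤ a) (hst : (k - 1) * N = s + a * t) :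
    (pathFactorGame n k).WinsMidMove a s t ∅ B := by
  rcases hk.eq_or_lt with rfl | hk3
  · exact winsMidMove_two (by omega) hn (by omega) hB hBa hs (by simpa using hst)
  · obtain ⟨κ, rfl⟩ : ∃ κ, k = κ + 3 := ⟨k - 3, by omega⟩
    obtain ⟨J, rfl⟩ : ∃ J, N = a + 3 + J := ⟨N - (a + 3), by omega⟩
    have : (a + 3) * (κ + 1) ≤ (a + 3) * (κ + 3) := Nat.mul_le_mul_left _ (by omega)
    exact winsMidMove_of_three_le hn (by omega) hB hBa hs hst

theorem theorem3 (a k : ℕ) (ha : 1 ≤ a) (hk : 2 ≤ k) (hak : ¬ (a = 1 ∧ k = 2)) :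
    ∃ n₀ : ℕ, ∀ n : ℕ, n₀ ≤ n → k ∣ n →
      (pathFactorGame n k).duration a a
          = ((⌈(((k : ℚ) - 1) * (n : ℚ)) / ((k : ℚ) * (a : ℚ))⌉₊ : ℕ) : ℕ∞) ∧
        (pathFactorGame n k).PerfectlyFast a ∧
        (pathFactorGame n k).RedWinsStrong a := by
  refine ⟨k * (a + 3 + (a + (a + 3) * k)), ?_⟩
  rintro n hn₀ ⟨N, rfl⟩
  have hN := Nat.le_of_mul_le_mul_left hn₀ (show 0 < k by omega)
  set G := pathFactorGame (k * N) k with hG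
  have hm : ∀ F ∈ G.winning, F.card = (k - 1) * N := by
    rintro F ⟨H, hH, hF⟩
    exact hH.card_edges (by omega) (by simp) hF
  have hm0 : 0 < (k - 1) * N := Nat.mul_pos (by omega) (by omega)
  obtain ⟨t, ht1, ht2⟩ : ∃ t, a * t < (k - 1) * N ∧ (k - 1) * N ≤ a * (t + 1) := by
    refine ⟨((k - 1) * N - 1) / a, ?_, ?_⟩
    · have := Nat.mul_div_le ((k - 1) * N - 1) a
      omega
    · have := Nat.lt_mul_div_succ ((k - 1) * N - 1) (show 0 < a by omega)
      omega
  -- `B` is Breaker's opening move, or empty when Red starts.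
  have hwin : ∀ B ⊆ G.board, B.card ≤ a → G.WinsIn a (t + 1) ∅ B := fun B hB hBa => by
    rw [mul_add, mul_one] at ht2
    -- The first move is the short one, with `m - a * t` planned claims, so that all later moves are
    -- full.
    exact (winsMidMove_pathFactorGame (s := (k - 1) * N - a * t) hk hak ha rfl hN hB hBa
      (by omega) (by omega)).winsIn (by omega)
  have hmaker := makerWinsWithin_of_winsIn hwin
  have hdur : G.duration a a = (t + 1 : ℕ) := duration_eq hmaker fun t' ht' => by
    obtain ⟨F, hF, hle⟩ := ht'.exists_card_le
    rw [hm F hF] at hle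
    exact Nat.lt_of_mul_lt_mul_left (ht1.trans_le hle)
  have ha0 : (0 : ℚ) < a := by exact_mod_cast ha
  have hceil : ⌈(((k - 1) * N : ℕ) : ℚ) / (a : ℚ)⌉₊ = t + 1 := by
    rw [Nat.ceil_eq_iff (by omega), lt_div_iff₀ ha0, div_le_iff₀ ha0]
    constructor
    · rw [Nat.add_sub_cancel, mul_comm]
      exact_mod_cast ht1
    · rw [mul_comm _ (a : ℚ)]
      exact_mod_cast ht2
  refine ⟨?_, ⟨(k - 1) * N, ⟨?_, ?_⟩, ?_⟩, ?_⟩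
  · rw [hdur, ← hceil]
    have hk0 : (k : ℚ) ≠ 0 := by exact_mod_cast (by omega : k ≠ 0)
    have : (((k - 1) * N : ℕ) : ℚ) / a = ((k : ℚ) - 1) * ((k * N : ℕ) : ℚ) / (k * a) := by
      push_cast [Nat.cast_sub (show 1 ≤ k by omega)]
      field_simp
    rw [this]
  · obtain ⟨F, hF, -⟩ := hmaker.exists_card_le
    exact ⟨F, hF, hm F hF⟩
  · rintro _ ⟨F, hF, rfl⟩
    exact (hm F hF).ge
  · rw [hdur, hceil]
  · exact redWinsStrong_of_winsIn (hwin ∅ (by simp) (by simp)) fun F hF => (hm F hF).symm ▸ ht1
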